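/- Let $M$ be a closed connected surface with a triangulation $\mathcal T=(V,E,F)$ (a finite simplicial complex with vertex set $V$, edge set $E$ and set of triangles $F$), and let $I:E\to(-1,+\infty)$, $\{i,j\}\mapsto I_{ij}$, be a function (the inversive distance) such that for every triangle $\{i,j,k\}\in F$ $$I_{ij}+I_{ik}I_{jk}\ge 0,\qquad I_{ik}+I_{ij}I_{jk}\ge 0,\qquad I_{jk}+I_{ij}I_{ik}\ge 0 .$$ For $r:V\to(0,+\infty)$ assign to each edge $\{i,j\}\in E$ the length $$l_{ij}=\sqrt{r_i^2+r_j^2+2r_ir_jI_{ij}}\quad\text{(Euclidean case)},$$ $$l_{ij}=\cosh^{-1}\bigl(\cosh r_i\cosh r_j+I_{ij}\sinh r_i\sinh r_j\bigr)\quad\text{(hyperbolic case)}.$$ Call $r$ a Euclidean (respectively hyperbolic) inversive distance circle packing on $(M,\mathcal T,I)$ if for every triangle in $F$ the three corresponding lengths of its edges satisfy the strict triangle inequalities. In that case every $\{i,j,k\}\in F$ is realised by a Euclidean (respectively hyperbolic, of curvature $-1$) triangle with side lengths $l_{ij},l_{ik},l_{jk}$; let $\theta_i^{jk}$ be its inner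 angle at $i$, and define the combinatorial curvature $K(r):V\to\mathbb R$ by $$K_i(r)=2\pi-\sum_{\{i,j,k\}\in F}\theta_i^{jk},$$ the sum being over all triangles that have $i$ as a vertex. 1. If $r$ and $r'$ are Euclidean inversive distance circle packings on $(M,\mathcal T,I)$ with $K(r)=K(r')$, then there is a constant $c>0$ with $r'_i=c\,r_i$ for all $i\in V$. 2. If $r$ and $r'$ are hyperbolic inversive distance circle packings on $(M,\mathcal T,I)$ with $K(r)=K(r')$, then $r=r'$. -/

import Mathlib

open scoped BigOperators

/-- The 1-skeleton of a family `F` of triangles on the vertex set `V`: two different vertices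
are adjacent when some triangle contains both. -/
def skeletonGraph {V : Type*} (F : Finset (Finset V)) : SimpleGraph V where
  Adj i j := i ≠ j ∧ ∃ f ∈ F, i ∈ f ∧ j ∈ f
  symm := ⟨fun _ _ h => ⟨h.1.symm, h.2.imp fun _ hf => ⟨hf.1, hf.2.2, hf.2.1⟩⟩⟩
  loopless := ⟨fun _ h => h.1 rfl⟩

/-- The edges of the link of the vertex `v`: the pairs `{j, k}` for which `{v, j, k}` is
a triangle of `F`. -/
def linkGraph {V : Type*} [DecidableEq V] (F : Finset (Finset V)) (v : V) : SimpleGraph V where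
  Adj j k := j ≠ k ∧ v ≠ j ∧ v ≠ k ∧ ({v, j, k} : Finset V) ∈ F
  symm := ⟨fun j k h => ⟨h.1.symm, h.2.2.1, h.2.1, by
    rw [Finset.pair_comm k j]; exact h.2.2.2⟩⟩
  loopless := ⟨fun _ h => h.1 rfl⟩

/-- A triangulation of a closed connected surface with vertex set `V`, as a finite pure
two-dimensional abstract simplicial complex, given by its set `faces` of triangles.
The underlying space is a closed surface exactly when the link of every vertex is a cycle
(in particular every vertex lies in a triangle and every edge lies in exactly two triangles),
and it is connected exactly when the 1-skeleton is. -/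
structure ClosedTriangulatedSurface (V : Type*) [Fintype V] [DecidableEq V] where
  /-- The triangles, each given by its set of vertices. -/
  faces : Finset (Finset V)
  card_eq_three : ∀ f ∈ faces, f.card = 3
  link_cycle : ∀ v : V, ∃ n : ℕ, 3 ≤ n ∧
    Nonempty ((linkGraph faces v).induce ((skeletonGraph faces).neighborSet v) ≃g
      SimpleGraph.cycleGraph n)
  connected : (skeletonGraph faces).Connected

/-- The angle opposite to the side of length `a` in a Euclidean triangle with side lengths
`a, b, c` (Euclidean law of cosines). -/
noncomputable def euclideanAngle (a b c : ℝ) : ℝ :=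
  Real.arccos ((b ^ 2 + c ^ 2 - a ^ 2) / (2 * b * c))

/-- The angle opposite to the side of length `a` in a hyperbolic triangle (curvature `-1`) with
side lengths `a, b, c` (hyperbolic law of cosines). -/
noncomputable def hyperbolicAngle (a b c : ℝ) : ℝ :=
  Real.arccos ((Real.cosh b * Real.cosh c - Real.cosh a) / (Real.sinh b * Real.sinh c))

/-- The Euclidean length of the edge `{i, j}` for the inversive distance `I` and radii `r`. -/
noncomputable def euclideanLength {V : Type*} (I : Sym2 V → ℝ) (r : V → ℝ) (i j : V) : ℝ :=
  Real.sqrt (r i ^ 2 + r j ^ 2 + 2 * r i * r j * I s(i, j))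

/-- The hyperbolic length of the edge `{i, j}` for the inversive distance `I` and radii `r`. -/
noncomputable def hyperbolicLength {V : Type*} (I : Sym2 V → ℝ) (r : V → ℝ) (i j : V) : ℝ :=
  Real.arcosh
    (Real.cosh (r i) * Real.cosh (r j) + I s(i, j) * (Real.sinh (r i) * Real.sinh (r j)))

namespace ClosedTriangulatedSurface

variable {V : Type*} [Fintype V] [DecidableEq V]

/-- The edges `{i, j}` of the triangulation, as a graph on the vertices. -/
def graph (T : ClosedTriangulatedSurface V) : SimpleGraph V :=
  skeletonGraph T.faces

/-- The edge lengths `l` satisfy the strict triangle inequalities on every face. All orderings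
of the vertices of a face occur as `(i, j, k)`. -/
def TriangleInequalities (T : ClosedTriangulatedSurface V) (l : V → V → ℝ) : Prop :=
  ∀ i j k : V, ({i, j, k} : Finset V) ∈ T.faces → l j k < l i j + l i k

/-- `r` is a Euclidean inversive distance circle packing metric. -/
def IsEuclideanPacking (T : ClosedTriangulatedSurface V) (I : Sym2 V → ℝ) (r : V → ℝ) : Prop :=
  (∀ i, 0 < r i) ∧ T.TriangleInequalities (euclideanLength I r)

/-- `r` is a hyperbolic inversive distance circle packing metric. -/
def IsHyperbolicPacking (T : ClosedTriangulatedSurface V) (I : Sym2 V → ℝ) (r : V → ℝ) : Prop :=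
  (∀ i, 0 < r i) ∧ T.TriangleInequalities (hyperbolicLength I r)

/-- The sum, over all triangles with vertex `i`, of the inner angle at `i`, when the edges have
lengths `l` and `angle a b c` is the angle opposite to `a` in a triangle with sides `a, b, c`.
Each triangle `{i, j, k}` is met twice, as `(j, k)` and as `(k, j)`, hence the division by two. -/
noncomputable def angleSum (T : ClosedTriangulatedSurface V) (angle : ℝ → ℝ → ℝ → ℝ)
    (l : V → V → ℝ) (i : V) : ℝ :=
  (∑ j, ∑ k, if ({i, j, k} : Finset V) ∈ T.faces then angle (l j k) (l i j) (l i k) else 0) / 2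

/-- The combinatorial curvature of a Euclidean packing. -/
noncomputable def euclideanCurvature (T : ClosedTriangulatedSurface V) (I : Sym2 V → ℝ)
    (r : V → ℝ) (i : V) : ℝ :=
  2 * Real.pi - T.angleSum euclideanAngle (euclideanLength I r) i

/-- The combinatorial curvature of a hyperbolic packing. -/
noncomputable def hyperbolicCurvature (T : ClosedTriangulatedSurface V) (I : Sym2 V → ℝ)
    (r : V → ℝ) (i : V) : ℝ :=
  2 * Real.pi - T.angleSum hyperbolicAngle (hyperbolicLength I r) i

end ClosedTriangulatedSurface

/-! Use the conformal coordinate `u = log r` in the Euclidean case and `u = log tanh (r / 2)` in the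
hyperbolic case. Let `v = u' - u` be the difference of the two packings, and join them by the path
of radii affine in `u`. On one triangle put `f = v₁ θ₁ + v₂ θ₂ + v₃ θ₃`, where the law of cosines is
read through `Real.arccos`, so that the angles remain continuous when the triangle inequalities fail
along the path.

While the triangle is nondegenerate (Gram determinant `W > 0`), `f'` is `-1 / √W` times a quadratic
form in `v`. This form is positive definite in the hyperbolic case and positive definite modulo the
scaling direction `(1, 1, 1)` in the Euclidean case. Where `W ≤ 0` every angle is `0` or `π`, so `f`
has finitely many possible values there and, being continuous, cannot climb. Hence `f 1 < f 0`
unless `v` is trivial on the face (`lt_of_deriv_neg_of_finite_values`, `weighted_angle_sum_lt`). The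
set of admissible radii need not be convex or connected.

Summed over the faces, these inequalities compare `∑ v i * angleSum i` for the two packings. Equal
curvatures make the two sums equal, so `v` is trivial on every face (`forall_faces_of_angleSum_eq`).
In the Euclidean case `v` is then constant by connectedness; in the hyperbolic case it vanishes.

Definiteness is where the conditions on `I` enter. Each edge has a weight with the sign of a signed
height, and at most one height is nonpositive (`height_pos_of_nonpos`). The determinant of the form,
or of its reduction modulo scaling, is a positive multiple of a power of `W` times a polynomial that
`length_det_pos` shows to be positive. In the Euclidean case this suffices (`euclidean_form_pos`). A
hyperbolic triangle with a nonpositive height also needs a positive `2 × 2` minor, which is obtained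
by deforming the inversive distances until that height vanishes (`IsCircleTriple.minor_pos`). -/

/-! ### Monotonicity across degenerate triangles, and derivatives of angles -/

/-- A continuous function on `[0, 1]` that takes only finitely many values where `W ≤ 0`, and has
negative derivative where `W > 0`, is smaller at `1` than at `0` if `W 0 > 0`. -/
theorem lt_of_deriv_neg_of_finite_values {f W : ℝ → ℝ} {A : Set ℝ} (hA : A.Finite)
    (hf : ContinuousOn f (Set.Icc 0 1)) (hW : ContinuousOn W (Set.Icc 0 1)) (hW0 : 0 < W 0)
    (hdeg : ∀ t ∈ Set.Icc (0 : ℝ) 1, W t ≤ 0 → f t ∈ A)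
    (hder : ∀ t ∈ Set.Ioo (0 : ℝ) 1, 0 < W t → ∃ f', f' < 0 ∧ HasDerivAt f f' t) :
    f 1 < f 0 := by
  have anti : ∀ s ∈ Set.Icc (0 : ℝ) 1, ∀ t ∈ Set.Icc (0 : ℝ) 1, s ≤ t → f t ≤ f s := by
    intro s hs t ht hst
    by_contra! hlt
    -- A level `y` outside the finite set `A` forces `W > 0` wherever `f = y`. At the last time `m`
    -- with `f ≤ y` the derivative is therefore negative, although `f` exceeds `y` just afterwards.
    obtain ⟨y, ⟨hy1, hy2⟩, hyA⟩ := ((Set.Ioo_infinite hlt).sdiff hA).nonempty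
    have hsub : Set.Icc s t ⊆ Set.Icc 0 1 := Set.Icc_subset_Icc hs.1 ht.2
    set S : Set ℝ := {τ ∈ Set.Icc s t | f τ ∈ Set.Iic y} with hS
    have hSc : IsClosed S :=
      (hf.mono hsub).preimage_isClosed_of_isClosed isClosed_Icc isClosed_Iic
    have hSne : S.Nonempty := ⟨s, ⟨le_rfl, hst⟩, hy1.le⟩
    have hSb : BddAbove S := ⟨t, fun τ hτ => hτ.1.2⟩
    obtain ⟨⟨hm1, hm2⟩, hm3⟩ := hSc.csSup_mem hSne hSb
    set m := sSup S with hm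
    have hm3' : f m ≤ y := hm3
    have hmt : m < t := lt_of_le_of_ne hm2 (by rintro h; rw [h] at hm3'; linarith)
    have habove : ∀ τ ∈ Set.Ioc m t, y < f τ := by
      intro τ hτ
      by_contra! h
      exact absurd (le_csSup hSb (show τ ∈ S from ⟨⟨hm1.trans hτ.1.le, hτ.2⟩, h⟩))
        (not_le.mpr hτ.1)
    have hcm : ContinuousWithinAt f (Set.Ioc m t) m :=
      (hf m (hsub ⟨hm1, hm2⟩)).mono
        (fun τ hτ => hsub ⟨hm1.trans hτ.1.le, hτ.2⟩)
    have hclos : m ∈ closure (Set.Ioc m t) := by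
      rw [closure_Ioc hmt.ne]; exact ⟨le_rfl, hmt.le⟩
    have hge : y ≤ f m := by
      exact ContinuousWithinAt.closure_le hclos (f := fun _ => y) continuousWithinAt_const hcm
        (fun τ hτ => (habove τ hτ).le)
    have hfm : f m = y := le_antisymm hm3' hge
    have hms : s < m := lt_of_le_of_ne hm1 (by rintro h; rw [← h] at hfm; linarith)
    have hmI : m ∈ Set.Ioo (0 : ℝ) 1 := ⟨hs.1.trans_lt hms, hmt.trans_le ht.2⟩
    have hWm : 0 < W m := by
      by_contra! h
      exact hyA (hfm ▸ hdeg m ⟨hmI.1.le, hmI.2.le⟩ h)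
    obtain ⟨f', hf', hd⟩ := hder m hmI hWm
    have hev := hd.tendsto_slope.eventually (gt_mem_nhds hf')
    have hev' : ∀ᶠ τ in nhdsWithin m (Set.Ioi m), slope f m τ < 0 :=
      hev.filter_mono (nhdsWithin_mono _ (fun τ (hτ : m < τ) => hτ.ne'))
    obtain ⟨τ, hτ1, hτ2⟩ := (hev'.and (Ioc_mem_nhdsGT hmt)).exists
    rw [slope_def_field, div_neg_iff] at hτ1
    have h1 := habove τ hτ2
    rcases hτ1 with h | h
    · linarith [h.2, hτ2.1]
    · linarith [h.1]
  by_contra! hle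
  -- Being nonincreasing with `f 0 ≤ f 1` makes `f` constant, which contradicts the negative
  -- derivative at small times, where `W` is still positive.
  have hconst : ∀ t ∈ Set.Icc (0 : ℝ) 1, f t = f 0 := fun t ht =>
    le_antisymm (anti 0 ⟨le_rfl, zero_le_one⟩ t ht ht.1)
      (hle.trans (anti t ht 1 ⟨zero_le_one, le_rfl⟩ ht.2))
  have h0 : ContinuousWithinAt W (Set.Ioo 0 1) 0 :=
    (hW 0 ⟨le_rfl, zero_le_one⟩).mono Set.Ioo_subset_Icc_self
  have hne : (nhdsWithin (0 : ℝ) (Set.Ioo 0 1)).NeBot := by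
    rw [← mem_closure_iff_nhdsWithin_neBot, closure_Ioo zero_ne_one]
    exact ⟨le_rfl, zero_le_one⟩
  obtain ⟨t, ht1, ht2⟩ := ((h0.eventually (lt_mem_nhds hW0)).and self_mem_nhdsWithin).exists
  obtain ⟨f', hf', hd⟩ := hder t ht2 ht1
  have heq : f =ᶠ[nhds t] fun _ => f 0 := by
    filter_upwards [Ioo_mem_nhds ht2.1 ht2.2] with τ hτ using hconst τ ⟨hτ.1.le, hτ.2.le⟩
  have := hd.unique ((hasDerivAt_const t (f 0)).congr_of_eventuallyEq heq)
  linarith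

/-- The derivative of the angle given by a law of cosines. -/
theorem HasDerivAt.arccos_div_sqrt {N p q : ℝ → ℝ} {N' p' q' t : ℝ} (hN : HasDerivAt N N' t)
    (hp : HasDerivAt p p' t) (hq : HasDerivAt q q' t) (hp0 : 0 < p t) (hq0 : 0 < q t)
    (hW : 0 < p t * q t - N t ^ 2) :
    HasDerivAt (fun τ => Real.arccos (N τ / √(p τ * q τ)))
      (-(N' - N t * (p' / (2 * p t) + q' / (2 * q t))) / √(p t * q t - N t ^ 2)) t := by
  have hpq : 0 < p t * q t := mul_pos hp0 hq0
  have hs : 0 < √(p t * q t) := Real.sqrt_pos.mpr hpq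
  have hss : √(p t * q t) ^ 2 = p t * q t := Real.sq_sqrt hpq.le
  have hw : 0 < √(p t * q t - N t ^ 2) := Real.sqrt_pos.mpr hW
  have hz : (N t / √(p t * q t)) ^ 2 < 1 := by
    rw [div_pow, hss, div_lt_one hpq]; linarith
  obtain ⟨hz1, hz2⟩ := abs_lt.mp ((sq_lt_one_iff_abs_lt_one _).mp hz)
  have hd := hN.div ((hp.mul hq).sqrt hpq.ne') hs.ne'
  have h := (Real.hasDerivAt_arccos hz1.ne' hz2.ne).comp t hd
  have hrt : √(1 - (N t / √(p t * q t)) ^ 2) = √(p t * q t - N t ^ 2) / √(p t * q t) := by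
    rw [div_pow, hss, ← Real.sqrt_div hW.le]
    congr 1
    field_simp
  refine h.congr_deriv ?_
  rw [hrt]
  set s := √(p t * q t) with hsdef
  simp only [Pi.mul_apply]
  rw [← hsdef]
  field_simp
  rw [hss]

/-- Where the law of cosines gives a value outside `(-1, 1)` the angle is `0` or `π`. -/
theorem arccos_div_sqrt_degenerate {N p : ℝ} (hp : 0 < p) (h : p - N ^ 2 ≤ 0) :
    Real.arccos (N / √p) = 0 ∨ Real.arccos (N / √p) = Real.pi := by
  have hs : 0 < √p := Real.sqrt_pos.mpr hp
  have hss : √p ^ 2 = p := Real.sq_sqrt hp.le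
  have h1 : √p ≤ |N| := by
    rw [← Real.sqrt_sq_eq_abs]; exact Real.sqrt_le_sqrt (by linarith)
  rcases le_abs.mp h1 with h | h
  · left; exact Real.arccos_eq_zero.mpr ((one_le_div hs).mpr h)
  · right
    exact Real.arccos_eq_pi.mpr (by rw [div_le_iff₀ hs]; linarith)

/-! ### Inequalities between inversive distances -/

/-- The expression factors as `(1 + a) * (1 + b) * (1 + c)`. -/
theorem sum_inversive_distances_pos {a b c : ℝ} (ha : -1 < a) (hb : -1 < b) (hc : -1 < c) :
    0 < 1 + a * b * c + (a + b * c) + (b + a * c) + (c + a * b) := by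
  have := mul_pos (mul_pos (neg_lt_iff_pos_add'.mp ha) (neg_lt_iff_pos_add'.mp hb))
    (neg_lt_iff_pos_add'.mp hc)
  linarith [this]

/-- Of the three signed heights at most one is nonpositive. -/
theorem height_pos_of_nonpos {a b c P₁ P₂ P₃ : ℝ} (ha : -1 < a) (hb : -1 < b) (hc : -1 < c)
    (h₁ : 0 ≤ a + b * c) (h₂ : 0 ≤ b + a * c) (h₃ : 0 ≤ c + a * b)
    (hP₁ : 0 < P₁) (hP₂ : 0 < P₂) (hP₃ : 0 < P₃)
    (h : P₁ * (1 - a ^ 2) + P₂ * (c + a * b) + P₃ * (b + a * c) ≤ 0) :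
    0 < P₂ * (1 - b ^ 2) + P₁ * (c + a * b) + P₃ * (a + b * c) := by
  have e2 := mul_nonneg hP₂.le h₃
  have e3 := mul_nonneg hP₃.le h₂
  have e2' := mul_nonneg hP₁.le h₃
  have e3' := mul_nonneg hP₃.le h₁
  have ha1 : 1 ≤ a := by
    by_contra! h'
    have : 0 < P₁ * (1 - a ^ 2) := mul_pos hP₁ (by nlinarith)
    linarith
  by_contra! h'
  have hb1 : 1 ≤ b := by
    by_contra! hb1
    have : 0 < P₂ * (1 - b ^ 2) := mul_pos hP₂ (by nlinarith)
    linarith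
  -- If two heights were nonpositive, discarding a nonnegative term from each and multiplying would
  -- give `(c + a * b) ^ 2 ≤ (a ^ 2 - 1) * (b ^ 2 - 1)`. The factorisation `i5` rules this out when
  -- `a, b ≥ 1` and `c > -1`.
  have i1 : P₂ * (c + a * b) ≤ P₁ * (a ^ 2 - 1) := by linarith
  have i2 : P₁ * (c + a * b) ≤ P₂ * (b ^ 2 - 1) := by linarith
  have i3 : (P₂ * (c + a * b)) * (P₁ * (c + a * b)) ≤ (P₁ * (a ^ 2 - 1)) * (P₂ * (b ^ 2 - 1)) :=
    mul_le_mul i1 i2 e2' (e2.trans i1)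
  have i4 : (P₁ * P₂) * ((c + a * b) ^ 2 - (a ^ 2 - 1) * (b ^ 2 - 1)) ≤ 0 := by linarith
  have i5 : (c + a * b) ^ 2 - (a ^ 2 - 1) * (b ^ 2 - 1)
      = (c + 1) * (c - 1 + 2 * (a * b)) + (a - b) ^ 2 := by ring
  have i6 : 1 ≤ a * b := by nlinarith
  have i7 : 0 < (c + 1) * (c - 1 + 2 * (a * b)) := mul_pos (by linarith) (by nlinarith)
  have i8 := mul_pos (mul_pos hP₁ hP₂)
    (by rw [i5]; positivity : 0 < (c + a * b) ^ 2 - (a ^ 2 - 1) * (b ^ 2 - 1))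
  linarith

/-- The determinant of the derivative of the edge lengths is positive, in homogeneous form:
`x / X` etc. are the radii. -/
theorem length_det_pos {a b c x y z X Y Z : ℝ} (ha : -1 < a) (hb : -1 < b) (hc : -1 < c)
    (h₁ : 0 ≤ a + b * c) (h₂ : 0 ≤ b + a * c) (h₃ : 0 ≤ c + a * b)
    (hx : 0 < x) (hy : 0 < y) (hz : 0 < z) (hX : 0 < X) (hY : 0 < Y) (hZ : 0 < Z) :
    0 < (y * Z + a * (Y * z)) * (z * X + b * (Z * x)) * (x * Y + c * (X * y))
      + (z * Y + a * (Z * y)) * (x * Z + b * (X * z)) * (y * X + c * (Y * x)) := by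
  have e := sum_inversive_distances_pos ha hb hc
  have e0 : 0 < x * y * z * X * Y * Z := by positivity
  have k1 : 0 ≤ (a + b * c) * (x * X * (y * Z - z * Y) ^ 2) := by positivity
  have k2 : 0 ≤ (b + a * c) * (y * Y * (x * Z - z * X) ^ 2) := by positivity
  have k3 : 0 ≤ (c + a * b) * (z * Z * (x * Y - y * X) ^ 2) := by positivity
  have e1 := mul_pos e0 e
  -- The goal's right side equals `2 * e1 + k1 + k2 + k3`: the mixed monomials pair up into squares,
  -- and what remains is a multiple of `(1 + a) * (1 + b) * (1 + c)`.
  nlinarith [e1, k1, k2, k3]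

/-! ### Definiteness of the Euclidean form modulo scaling -/

/-- The conformal Laplacian form of a Euclidean triangle. -/
theorem euclidean_form_pos_aux {w₁ w₂ w₃ v₁ v₂ v₃ : ℝ} (h : 0 < w₂ + w₃)
    (hE : 0 < w₁ * w₂ + w₁ * w₃ + w₂ * w₃) (hv : ¬ (v₁ = v₂ ∧ v₁ = v₃)) :
    0 < w₁ * (v₂ - v₃) ^ 2 + w₂ * (v₁ - v₃) ^ 2 + w₃ * (v₁ - v₂) ^ 2 := by
  -- Completing the square in the differences of the `vᵢ`: one weight may be negative as long as the
  -- other two have positive sum and the second elementary symmetric function of the weights is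
  -- positive.
  have key : (w₂ + w₃) * (w₁ * (v₂ - v₃) ^ 2 + w₂ * (v₁ - v₃) ^ 2 + w₃ * (v₁ - v₂) ^ 2)
      = (w₂ * (v₁ - v₃) + w₃ * (v₁ - v₂)) ^ 2
        + (w₁ * w₂ + w₁ * w₃ + w₂ * w₃) * (v₂ - v₃) ^ 2 := by ring
  refine pos_of_mul_pos_right (a := w₂ + w₃) ?_ h.le
  rw [key]
  by_cases h23 : v₂ = v₃
  · have : v₁ - v₂ ≠ 0 := fun h' => hv ⟨by linarith, by linarith⟩
    have e : w₂ * (v₁ - v₃) + w₃ * (v₁ - v₂) = (w₂ + w₃) * (v₁ - v₂) := by rw [h23]; ring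
    rw [e]; have := mul_ne_zero h.ne' this; positivity
  · have : v₂ - v₃ ≠ 0 := sub_ne_zero.mpr h23
    positivity

/-- The second elementary symmetric function of the weights factors as the Gram determinant times `x
* y * z` times the quantity of `length_det_pos`, over `s₁ * s₂ * s₃`. Since at most one height is
nonpositive, some pair of weights has positive sum, and `euclidean_form_pos_aux` applies after
relabelling the vertices. -/
theorem euclidean_form_pos {a b c x y z s₁ s₂ s₃ v₁ v₂ v₃ : ℝ}
    (ha : -1 < a) (hb : -1 < b) (hc : -1 < c)
    (h₁ : 0 ≤ a + b * c) (h₂ : 0 ≤ b + a * c) (h₃ : 0 ≤ c + a * b)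
    (hx : 0 < x) (hy : 0 < y) (hz : 0 < z)
    (hs₁ : s₁ = y ^ 2 + z ^ 2 + 2 * y * z * a) (hs₂ : s₂ = x ^ 2 + z ^ 2 + 2 * x * z * b)
    (hs₃ : s₃ = x ^ 2 + y ^ 2 + 2 * x * y * c) (p₁ : 0 < s₁) (p₂ : 0 < s₂) (p₃ : 0 < s₃)
    (hW : 0 < s₂ * s₃ - ((s₂ + s₃ - s₁) / 2) ^ 2) (hv : ¬ (v₁ = v₂ ∧ v₁ = v₃)) :
    0 < y * z * (y * z * (1 - a ^ 2) + x * z * (c + a * b) + x * y * (b + a * c)) / s₁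
          * (v₂ - v₃) ^ 2
      + x * z * (x * z * (1 - b ^ 2) + y * z * (c + a * b) + x * y * (a + b * c)) / s₂
          * (v₁ - v₃) ^ 2
      + x * y * (x * y * (1 - c ^ 2) + y * z * (b + a * c) + x * z * (a + b * c)) / s₃
          * (v₁ - v₂) ^ 2 := by
  set H₁ := y * z * (1 - a ^ 2) + x * z * (c + a * b) + x * y * (b + a * c) with hH₁
  set H₂ := x * z * (1 - b ^ 2) + y * z * (c + a * b) + x * y * (a + b * c) with hH₂
  set H₃ := x * y * (1 - c ^ 2) + y * z * (b + a * c) + x * z * (a + b * c) with hH₃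
  have hyz := mul_pos hy hz
  have hxz := mul_pos hx hz
  have hxy := mul_pos hx hy
  have hD := length_det_pos (X := 1) (Y := 1) (Z := 1) ha hb hc h₁ h₂ h₃ hx hy hz
    one_pos one_pos one_pos
  have hE : 0 < (y * z * H₁ / s₁) * (x * z * H₂ / s₂) + (y * z * H₁ / s₁) * (x * y * H₃ / s₃)
      + (x * z * H₂ / s₂) * (x * y * H₃ / s₃) := by
    have : (y * z * H₁ / s₁) * (x * z * H₂ / s₂) + (y * z * H₁ / s₁) * (x * y * H₃ / s₃)
      + (x * z * H₂ / s₂) * (x * y * H₃ / s₃)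
      = ((s₂ * s₃ - ((s₂ + s₃ - s₁) / 2) ^ 2) * (x * y * z) *
        ((y * 1 + a * (1 * z)) * (z * 1 + b * (1 * x)) * (x * 1 + c * (1 * y))
      + (z * 1 + a * (1 * y)) * (x * 1 + b * (1 * z)) * (y * 1 + c * (1 * x))))
        / (s₁ * s₂ * s₃) := by
      rw [show (y * z * H₁ / s₁) * (x * z * H₂ / s₂) + (y * z * H₁ / s₁) * (x * y * H₃ / s₃)
        + (x * z * H₂ / s₂) * (x * y * H₃ / s₃) =
        ((y * z * H₁) * (x * z * H₂) * s₃ + (y * z * H₁) * (x * y * H₃) * s₂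
        + (x * z * H₂) * (x * y * H₃) * s₁) / (s₁ * s₂ * s₃) by field_simp]
      congr 1
      rw [hH₁, hH₂, hH₃, hs₁, hs₂, hs₃]
      ring
    rw [this]
    exact div_pos (mul_pos (mul_pos hW (by positivity)) hD) (by positivity)
  rcases le_or_gt H₁ 0 with k₁ | k₁
  · have k₂ : 0 < H₂ := height_pos_of_nonpos ha hb hc h₁ h₂ h₃ hyz hxz hxy k₁
    have k₃ : 0 < H₃ := by
      have := height_pos_of_nonpos (b := c) (c := b) (P₂ := x * y) (P₃ := x * z) ha hc hb
        (by linarith) h₃ h₂ hyz hxy hxz (by linarith)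
      rw [hH₃]; linarith
    exact euclidean_form_pos_aux (by positivity) hE hv
  · rcases le_or_gt H₂ 0 with k₂ | k₂
    · have k₃ : 0 < H₃ := by
        have := height_pos_of_nonpos (a := b) (b := c) (c := a) (P₁ := x * z) (P₂ := x * y)
          (P₃ := y * z) hb hc ha (by linarith) (by linarith) (by linarith) hxz hxy hyz
          (by linarith)
        rw [hH₃]; linarith
      have := euclidean_form_pos_aux (w₁ := x * z * H₂ / s₂) (w₂ := y * z * H₁ / s₁)
        (w₃ := x * y * H₃ / s₃) (v₁ := v₂) (v₂ := v₁) (v₃ := v₃) (by positivity)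
        (by linarith) (fun h => hv ⟨h.1.symm, h.1.symm.trans h.2⟩)
      linarith [this]
    · have := euclidean_form_pos_aux (w₁ := x * y * H₃ / s₃) (w₂ := y * z * H₁ / s₁)
        (w₃ := x * z * H₂ / s₂) (v₁ := v₃) (v₂ := v₁) (v₃ := v₂) (by positivity)
        (by linarith) (fun h => hv ⟨h.1.symm.trans h.2, h.1.symm⟩)
      linarith [this]

/-! ### Algebra of the hyperbolic form -/

/-- The hyperbolic cosine of an edge length exceeds one. -/
theorem one_lt_cosh_length {C D S T I : ℝ} (hC : C ^ 2 = S ^ 2 + 1) (hD : D ^ 2 = T ^ 2 + 1)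
    (hC0 : 0 < C) (hD0 : 0 < D) (hS : 0 < S) (hT : 0 < T) (hI : -1 < I) :
    1 < C * D + I * (S * T) := by
  have hST := mul_pos hS hT
  have h1 : (1 + S * T) ^ 2 ≤ (C * D) ^ 2 := by
    rw [mul_pow, hC, hD]; nlinarith [sq_nonneg (S - T)]
  have h2 : 1 + S * T ≤ C * D := (sq_le_sq₀ (by positivity) (by positivity)).mp h1
  nlinarith

/-- A weighted sum of the three forms `c (x² + y²) - 2 x y` is positive definite by Sylvester's
criterion. -/
theorem hyperbolic_form_pos_of_minors {w₁ w₂ w₃ c₁ c₂ c₃ v₁ v₂ v₃ : ℝ}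
    (h₁ : 0 < w₃ * c₃ + w₂ * c₂)
    (h₂ : 0 < (w₃ * c₃ + w₂ * c₂) * (w₃ * c₃ + w₁ * c₁) - w₃ ^ 2)
    (h₃ : 0 < w₁ ^ 2 * (c₁ ^ 2 - 1) * (w₂ * c₂ + w₃ * c₃)
      + w₂ ^ 2 * (c₂ ^ 2 - 1) * (w₁ * c₁ + w₃ * c₃)
      + w₃ ^ 2 * (c₃ ^ 2 - 1) * (w₁ * c₁ + w₂ * c₂) + 2 * w₁ * w₂ * w₃ * (c₁ * c₂ * c₃ - 1))
    (hv : ¬ (v₁ = 0 ∧ v₂ = 0 ∧ v₃ = 0)) :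
    0 < w₁ * (c₁ * (v₂ ^ 2 + v₃ ^ 2) - 2 * v₂ * v₃) + w₂ * (c₂ * (v₁ ^ 2 + v₃ ^ 2) - 2 * v₁ * v₃)
      + w₃ * (c₃ * (v₁ ^ 2 + v₂ ^ 2) - 2 * v₁ * v₂) := by
  set A := w₃ * c₃ + w₂ * c₂ with hA
  set M := A * (w₃ * c₃ + w₁ * c₁) - w₃ ^ 2 with hM
  -- Two completions of the square, cleared of denominators. `A` and `M` are the leading minors of
  -- orders one and two, and the coefficient of `A * v₃ ^ 2` is the full determinant.
  have key : A * M * (w₁ * (c₁ * (v₂ ^ 2 + v₃ ^ 2) - 2 * v₂ * v₃)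
      + w₂ * (c₂ * (v₁ ^ 2 + v₃ ^ 2) - 2 * v₁ * v₃)
      + w₃ * (c₃ * (v₁ ^ 2 + v₂ ^ 2) - 2 * v₁ * v₂))
      = M * (A * v₁ - w₃ * v₂ - w₂ * v₃) ^ 2 + (M * v₂ - (A * w₁ + w₂ * w₃) * v₃) ^ 2
        + A * (w₁ ^ 2 * (c₁ ^ 2 - 1) * (w₂ * c₂ + w₃ * c₃)
      + w₂ ^ 2 * (c₂ ^ 2 - 1) * (w₁ * c₁ + w₃ * c₃)
      + w₃ ^ 2 * (c₃ ^ 2 - 1) * (w₁ * c₁ + w₂ * c₂) + 2 * w₁ * w₂ * w₃ * (c₁ * c₂ * c₃ - 1))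
        * v₃ ^ 2 := by
    rw [hM, hA]; ring
  refine pos_of_mul_pos_right (a := A * M) ?_ (by positivity)
  rw [key]
  by_cases e3 : v₃ = 0
  · by_cases e2 : v₂ = 0
    · have e1 : v₁ ≠ 0 := fun e1 => hv ⟨e1, e2, e3⟩
      rw [e2, e3]
      have : A * v₁ ≠ 0 := mul_ne_zero h₁.ne' e1
      have e : A * v₁ - w₃ * 0 - w₂ * 0 = A * v₁ := by ring
      rw [e]
      positivity
    · rw [e3]
      have : M * v₂ ≠ 0 := mul_ne_zero h₂.ne' e2
      have e : M * v₂ - (A * w₁ + w₂ * w₃) * 0 = M * v₂ := by ring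
      rw [e]
      positivity
  · positivity

/-- A weighted sum of the three forms `c (x² + y²) - 2 x y` with nonnegative weights, at least two
of them positive, is positive definite. -/
theorem hyperbolic_form_pos_of_weights {w₁ w₂ w₃ c₁ c₂ c₃ v₁ v₂ v₃ : ℝ}
    (h₁ : 0 ≤ w₁) (h₂ : 0 < w₂) (h₃ : 0 < w₃) (k₁ : 1 < c₁) (k₂ : 1 < c₂) (k₃ : 1 < c₃)
    (hv : ¬ (v₁ = 0 ∧ v₂ = 0 ∧ v₃ = 0)) :
    0 < w₁ * (c₁ * (v₂ ^ 2 + v₃ ^ 2) - 2 * v₂ * v₃) + w₂ * (c₂ * (v₁ ^ 2 + v₃ ^ 2) - 2 * v₁ * v₃)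
      + w₃ * (c₃ * (v₁ ^ 2 + v₂ ^ 2) - 2 * v₁ * v₂) := by
  have aux : ∀ c x y : ℝ, 1 < c →
      c * (x ^ 2 + y ^ 2) - 2 * x * y = (c - 1) * (x ^ 2 + y ^ 2) + (x - y) ^ 2 := by
    intros; ring
  rw [aux _ _ _ k₁, aux _ _ _ k₂, aux _ _ _ k₃]
  have := sub_pos.mpr k₁
  have := sub_pos.mpr k₂
  have := sub_pos.mpr k₃
  by_cases e1 : v₁ = 0
  · by_cases e2 : v₂ = 0
    · have e3 : v₃ ≠ 0 := fun e3 => hv ⟨e1, e2, e3⟩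
      positivity
    · positivity
  · positivity

/-- The determinant of the form of a hyperbolic triangle. -/
theorem hyperbolic_form_det {c₁ c₂ c₃ C₁ C₂ C₃ w₁ w₂ w₃ : ℝ}
    (p₁ : c₁ ^ 2 - 1 ≠ 0) (p₂ : c₂ ^ 2 - 1 ≠ 0) (p₃ : c₃ ^ 2 - 1 ≠ 0)
    (h₁ : w₁ = (C₂ * (c₁ * c₂ - c₃) + C₃ * (c₁ * c₃ - c₂) - C₁ * (c₁ ^ 2 - 1)) / (c₁ ^ 2 - 1))
    (h₂ : w₂ = (C₁ * (c₁ * c₂ - c₃) + C₃ * (c₂ * c₃ - c₁) - C₂ * (c₂ ^ 2 - 1)) / (c₂ ^ 2 - 1))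
    (h₃ : w₃ = (C₁ * (c₁ * c₃ - c₂) + C₂ * (c₂ * c₃ - c₁) - C₃ * (c₃ ^ 2 - 1)) / (c₃ ^ 2 - 1)) :
    w₁ ^ 2 * (c₁ ^ 2 - 1) * (w₂ * c₂ + w₃ * c₃) + w₂ ^ 2 * (c₂ ^ 2 - 1) * (w₁ * c₁ + w₃ * c₃)
      + w₃ ^ 2 * (c₃ ^ 2 - 1) * (w₁ * c₁ + w₂ * c₂) + 2 * w₁ * w₂ * w₃ * (c₁ * c₂ * c₃ - 1)
    = (1 + 2 * c₁ * c₂ * c₃ - c₁ ^ 2 - c₂ ^ 2 - c₃ ^ 2) ^ 2 *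
      ((C₂ * c₁ - C₃) * (C₃ * c₂ - C₁) * (C₁ * c₃ - C₂)
        + (C₃ * c₁ - C₂) * (C₁ * c₂ - C₃) * (C₂ * c₃ - C₁))
      / ((c₁ ^ 2 - 1) * (c₂ ^ 2 - 1) * (c₃ ^ 2 - 1)) := by
  rw [h₁, h₂, h₃]
  field_simp
  ring

/-- Differentiating the law of cosines yields weights in terms of the sides; here their numerator is
rewritten as a positive factor times a signed height, whose sign can be controlled. -/
theorem hyperbolic_weight_eq {a b c C₁ C₂ C₃ S₁ S₂ S₃ : ℝ}
    (k₂ : C₂ ^ 2 = S₂ ^ 2 + 1) (k₃ : C₃ ^ 2 = S₃ ^ 2 + 1) :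
    C₂ * ((C₂ * C₃ + a * (S₂ * S₃)) * (C₁ * C₃ + b * (S₁ * S₃)) - (C₁ * C₂ + c * (S₁ * S₂)))
      + C₃ * ((C₂ * C₃ + a * (S₂ * S₃)) * (C₁ * C₂ + c * (S₁ * S₂)) - (C₁ * C₃ + b * (S₁ * S₃)))
      - C₁ * ((C₂ * C₃ + a * (S₂ * S₃)) ^ 2 - 1)
    = S₂ * S₃ * (C₁ * (S₂ * S₃) * (1 - a ^ 2) + C₂ * (S₁ * S₃) * (c + a * b)
      + C₃ * (S₁ * S₂) * (b + a * c)) := by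
  ring_nf
  simp only [k₂, k₃]
  ring

/-- The Gram determinant of a hyperbolic triangle in terms of radii and inversive distances. -/
theorem hyperbolic_gram_eq {a b c C₁ C₂ C₃ S₁ S₂ S₃ : ℝ}
    (k₁ : C₁ ^ 2 = S₁ ^ 2 + 1) (k₂ : C₂ ^ 2 = S₂ ^ 2 + 1) (k₃ : C₃ ^ 2 = S₃ ^ 2 + 1) :
    1 + 2 * (C₂ * C₃ + a * (S₂ * S₃)) * (C₁ * C₃ + b * (S₁ * S₃)) * (C₁ * C₂ + c * (S₁ * S₂))
      - (C₂ * C₃ + a * (S₂ * S₃)) ^ 2 - (C₁ * C₃ + b * (S₁ * S₃)) ^ 2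
      - (C₁ * C₂ + c * (S₁ * S₂)) ^ 2
    = (C₁ * (S₂ * S₃)) ^ 2 * (1 - a ^ 2) + (C₂ * (S₁ * S₃)) ^ 2 * (1 - b ^ 2)
      + (C₃ * (S₁ * S₂)) ^ 2 * (1 - c ^ 2)
      + 2 * (C₁ * (S₂ * S₃)) * (C₂ * (S₁ * S₃)) * (c + a * b)
      + 2 * (C₁ * (S₂ * S₃)) * (C₃ * (S₁ * S₂)) * (b + a * c)
      + 2 * (C₂ * (S₁ * S₃)) * (C₃ * (S₁ * S₂)) * (a + b * c)
      + (S₁ * S₂ * S₃) ^ 2 * (a ^ 2 + b ^ 2 + c ^ 2 + 2 * a * b * c - 1) := by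
  ring_nf
  simp only [k₁, k₂, k₃]
  ring

/-- The Gram determinant increases with `b` and `c` while the first signed height is nonpositive. -/
theorem hyperbolic_gram_mono {a b c P₁ P₂ P₃ S τ : ℝ} (ha : 1 < a) (hbc : 0 ≤ b + c)
    (hP₂ : 0 < P₂) (hP₃ : 0 < P₃) (hτ : 0 ≤ τ)
    (h : P₁ * (1 - a ^ 2) + P₂ * ((c + τ) + a * (b + τ)) + P₃ * ((b + τ) + a * (c + τ)) ≤ 0) :
    P₁ ^ 2 * (1 - a ^ 2) + P₂ ^ 2 * (1 - b ^ 2) + P₃ ^ 2 * (1 - c ^ 2)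
      + 2 * P₁ * P₂ * (c + a * b) + 2 * P₁ * P₃ * (b + a * c) + 2 * P₂ * P₃ * (a + b * c)
      + S ^ 2 * (a ^ 2 + b ^ 2 + c ^ 2 + 2 * a * b * c - 1)
    ≤ P₁ ^ 2 * (1 - a ^ 2) + P₂ ^ 2 * (1 - (b + τ) ^ 2) + P₃ ^ 2 * (1 - (c + τ) ^ 2)
      + 2 * P₁ * P₂ * ((c + τ) + a * (b + τ)) + 2 * P₁ * P₃ * ((b + τ) + a * (c + τ))
      + 2 * P₂ * P₃ * (a + (b + τ) * (c + τ))
      + S ^ 2 * (a ^ 2 + (b + τ) ^ 2 + (c + τ) ^ 2 + 2 * a * (b + τ) * (c + τ) - 1) := by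
  -- The bracket is half the derivative of the Gram determinant as `b` and `c` grow at unit speed.
  -- The determinant is quadratic in `τ`, so its increment is exactly `τ` times the sum of the
  -- brackets at the two ends.
  have J : ∀ b c : ℝ, 0 ≤ b + c →
      P₁ * (1 - a ^ 2) + P₂ * (c + a * b) + P₃ * (b + a * c) ≤ 0 →
      0 ≤ P₁ * (P₂ + P₃) * (1 + a) + (P₃ - P₂) * (b * P₂ - c * P₃) + S ^ 2 * (1 + a) * (b + c) := by
    intro b c hbc h
    have ha1 : 0 < a - 1 := sub_pos.mpr ha
    have ha0 : 0 < a := by linarith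
    refine nonneg_of_mul_nonneg_right (a := a - 1) ?_ ha1
    have e1 : 0 ≤ (P₂ + P₃) * (P₁ * (a ^ 2 - 1) - P₂ * (c + a * b) - P₃ * (b + a * c)) :=
      mul_nonneg (by positivity) (by linarith)
    have e2 : 0 ≤ (b + c) * (P₂ ^ 2 + P₃ ^ 2 + 2 * a * (P₂ * P₃)) := by positivity
    have e3 : 0 ≤ (a - 1) * (S ^ 2 * (1 + a) * (b + c)) := by positivity
    linarith [e1, e2, e3]
  have h0 : P₁ * (1 - a ^ 2) + P₂ * (c + a * b) + P₃ * (b + a * c) ≤ 0 := by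
    have : 0 ≤ τ * (1 + a) * (P₂ + P₃) := by
      have : 0 < 1 + a := by linarith
      positivity
    linarith
  have j0 := mul_nonneg hτ (J b c hbc h0)
  have j1 := mul_nonneg hτ (J (b + τ) (c + τ) (by linarith) h)
  linarith [j0, j1]

/-! ### Circle triples and positivity of the hyperbolic form -/

/-- The first signed height of a hyperbolic triangle with `C i = cosh (r i)`, `S i = sinh (r i)`. -/
def hyperbolicHeight (C₁ S₁ C₂ S₂ C₃ S₃ a b c : ℝ) : ℝ :=
  C₁ * (S₂ * S₃) * (1 - a ^ 2) + C₂ * (S₁ * S₃) * (c + a * b) + C₃ * (S₁ * S₂) * (b + a * c)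

/-- The weight of the edge opposite to the first vertex of a hyperbolic triangle. -/
noncomputable def hyperbolicWeight (C₁ S₁ C₂ S₂ C₃ S₃ a b c : ℝ) : ℝ :=
  S₂ * S₃ * hyperbolicHeight C₁ S₁ C₂ S₂ C₃ S₃ a b c / ((C₂ * C₃ + a * (S₂ * S₃)) ^ 2 - 1)

/-- The data of a hyperbolic triangle of circles: hyperbolic cosines and sines of the radii and
inversive distances. -/
structure IsCircleTriple (C₁ S₁ C₂ S₂ C₃ S₃ a b c : ℝ) : Prop where
  sq₁ : C₁ ^ 2 = S₁ ^ 2 + 1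
  sq₂ : C₂ ^ 2 = S₂ ^ 2 + 1
  sq₃ : C₃ ^ 2 = S₃ ^ 2 + 1
  C₁_pos : 0 < C₁
  C₂_pos : 0 < C₂
  C₃_pos : 0 < C₃
  S₁_pos : 0 < S₁
  S₂_pos : 0 < S₂
  S₃_pos : 0 < S₃
  a_gt : -1 < a
  b_gt : -1 < b
  c_gt : -1 < c
  γ₁ : 0 ≤ a + b * c
  γ₂ : 0 ≤ b + a * c
  γ₃ : 0 ≤ c + a * b

/-- The Gram determinant of the triangle with given hyperbolic cosines of the sides. -/
def hyperbolicGram (c₁ c₂ c₃ : ℝ) : ℝ := 1 + 2 * c₁ * c₂ * c₃ - c₁ ^ 2 - c₂ ^ 2 - c₃ ^ 2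

/-- The quadratic form of the angle variation of a hyperbolic triangle. -/
noncomputable def hyperbolicForm (w₁ w₂ w₃ c₁ c₂ c₃ v₁ v₂ v₃ : ℝ) : ℝ :=
  w₁ * (c₁ * (v₂ ^ 2 + v₃ ^ 2) - 2 * v₂ * v₃) + w₂ * (c₂ * (v₁ ^ 2 + v₃ ^ 2) - 2 * v₁ * v₃)
      + w₃ * (c₃ * (v₁ ^ 2 + v₂ ^ 2) - 2 * v₁ * v₂)

/-- The principal `2 × 2` minor of `hyperbolicForm` for the first two vertices. -/
noncomputable def hyperbolicMinor (C₁ S₁ C₂ S₂ C₃ S₃ a b c : ℝ) : ℝ :=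
  (hyperbolicWeight C₃ S₃ C₁ S₁ C₂ S₂ c a b * (C₁ * C₂ + c * (S₁ * S₂))
      + hyperbolicWeight C₂ S₂ C₁ S₁ C₃ S₃ b a c * (C₁ * C₃ + b * (S₁ * S₃)))
    * (hyperbolicWeight C₃ S₃ C₁ S₁ C₂ S₂ c a b * (C₁ * C₂ + c * (S₁ * S₂))
      + hyperbolicWeight C₁ S₁ C₂ S₂ C₃ S₃ a b c * (C₂ * C₃ + a * (S₂ * S₃)))
    - hyperbolicWeight C₃ S₃ C₁ S₁ C₂ S₂ c a b ^ 2

namespace IsCircleTriple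

variable {C₁ S₁ C₂ S₂ C₃ S₃ a b c : ℝ}

theorem swap₁₂ (h : IsCircleTriple C₁ S₁ C₂ S₂ C₃ S₃ a b c) :
    IsCircleTriple C₂ S₂ C₁ S₁ C₃ S₃ b a c :=
  ⟨h.sq₂, h.sq₁, h.sq₃, h.C₂_pos, h.C₁_pos, h.C₃_pos, h.S₂_pos, h.S₁_pos, h.S₃_pos,
    h.b_gt, h.a_gt, h.c_gt, h.γ₂, h.γ₁, by linarith [h.γ₃]⟩

theorem swap₂₃ (h : IsCircleTriple C₁ S₁ C₂ S₂ C₃ S₃ a b c) :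
    IsCircleTriple C₁ S₁ C₃ S₃ C₂ S₂ a c b :=
  ⟨h.sq₁, h.sq₃, h.sq₂, h.C₁_pos, h.C₃_pos, h.C₂_pos, h.S₁_pos, h.S₃_pos, h.S₂_pos,
    h.a_gt, h.c_gt, h.b_gt, by linarith [h.γ₁], h.γ₃, h.γ₂⟩

theorem one_lt_c₁ (h : IsCircleTriple C₁ S₁ C₂ S₂ C₃ S₃ a b c) : 1 < C₂ * C₃ + a * (S₂ * S₃) :=
  one_lt_cosh_length h.sq₂ h.sq₃ h.C₂_pos h.C₃_pos h.S₂_pos h.S₃_pos h.a_gt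

theorem one_lt_c₂ (h : IsCircleTriple C₁ S₁ C₂ S₂ C₃ S₃ a b c) : 1 < C₁ * C₃ + b * (S₁ * S₃) :=
  h.swap₁₂.one_lt_c₁

theorem one_lt_c₃ (h : IsCircleTriple C₁ S₁ C₂ S₂ C₃ S₃ a b c) : 1 < C₁ * C₂ + c * (S₁ * S₂) :=
  h.swap₂₃.one_lt_c₂

theorem sq_c₁_sub_one_pos (h : IsCircleTriple C₁ S₁ C₂ S₂ C₃ S₃ a b c) :
    0 < (C₂ * C₃ + a * (S₂ * S₃)) ^ 2 - 1 :=
  sub_pos.mpr (one_lt_pow₀ h.one_lt_c₁ two_ne_zero)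

theorem sq_c₂_sub_one_pos (h : IsCircleTriple C₁ S₁ C₂ S₂ C₃ S₃ a b c) :
    0 < (C₁ * C₃ + b * (S₁ * S₃)) ^ 2 - 1 :=
  sub_pos.mpr (one_lt_pow₀ h.one_lt_c₂ two_ne_zero)

theorem sq_c₃_sub_one_pos (h : IsCircleTriple C₁ S₁ C₂ S₂ C₃ S₃ a b c) :
    0 < (C₁ * C₂ + c * (S₁ * S₂)) ^ 2 - 1 :=
  sub_pos.mpr (one_lt_pow₀ h.one_lt_c₃ two_ne_zero)

theorem height₂_pos (h : IsCircleTriple C₁ S₁ C₂ S₂ C₃ S₃ a b c)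
    (hH : hyperbolicHeight C₁ S₁ C₂ S₂ C₃ S₃ a b c ≤ 0) :
    0 < hyperbolicHeight C₂ S₂ C₁ S₁ C₃ S₃ b a c := by
  have := h.C₁_pos; have := h.C₂_pos; have := h.C₃_pos
  have := h.S₁_pos; have := h.S₂_pos; have := h.S₃_pos
  have := height_pos_of_nonpos (P₁ := C₁ * (S₂ * S₃)) (P₂ := C₂ * (S₁ * S₃)) (P₃ := C₃ * (S₁ * S₂))
    h.a_gt h.b_gt h.c_gt h.γ₁ h.γ₂ h.γ₃ (by positivity) (by positivity) (by positivity) hH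
  unfold hyperbolicHeight
  linarith

theorem height_swap₂₃ : hyperbolicHeight C₁ S₁ C₃ S₃ C₂ S₂ a c b
    = hyperbolicHeight C₁ S₁ C₂ S₂ C₃ S₃ a b c := by
  unfold hyperbolicHeight; ring

theorem weight_swap₂₃ : hyperbolicWeight C₁ S₁ C₃ S₃ C₂ S₂ a c b
    = hyperbolicWeight C₁ S₁ C₂ S₂ C₃ S₃ a b c := by
  unfold hyperbolicWeight
  rw [height_swap₂₃, mul_comm S₃ S₂, mul_comm C₃ C₂]

theorem height₃_pos (h : IsCircleTriple C₁ S₁ C₂ S₂ C₃ S₃ a b c)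
    (hH : hyperbolicHeight C₁ S₁ C₂ S₂ C₃ S₃ a b c ≤ 0) :
    0 < hyperbolicHeight C₃ S₃ C₁ S₁ C₂ S₂ c a b :=
  h.swap₂₃.height₂_pos (by rwa [height_swap₂₃])

theorem weight₁_pos (h : IsCircleTriple C₁ S₁ C₂ S₂ C₃ S₃ a b c)
    (hH : 0 < hyperbolicHeight C₁ S₁ C₂ S₂ C₃ S₃ a b c) :
    0 < hyperbolicWeight C₁ S₁ C₂ S₂ C₃ S₃ a b c := by
  have := h.S₂_pos; have := h.S₃_pos
  have : 0 < (C₂ * C₃ + a * (S₂ * S₃)) ^ 2 - 1 := h.sq_c₁_sub_one_pos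
  unfold hyperbolicWeight
  positivity

theorem weight₁_nonneg (h : IsCircleTriple C₁ S₁ C₂ S₂ C₃ S₃ a b c)
    (hH : 0 ≤ hyperbolicHeight C₁ S₁ C₂ S₂ C₃ S₃ a b c) :
    0 ≤ hyperbolicWeight C₁ S₁ C₂ S₂ C₃ S₃ a b c := by
  have := h.S₂_pos; have := h.S₃_pos
  have : 0 < (C₂ * C₃ + a * (S₂ * S₃)) ^ 2 - 1 := h.sq_c₁_sub_one_pos
  unfold hyperbolicWeight
  positivity

theorem weight₂_pos (h : IsCircleTriple C₁ S₁ C₂ S₂ C₃ S₃ a b c)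
    (hH : hyperbolicHeight C₁ S₁ C₂ S₂ C₃ S₃ a b c ≤ 0) :
    0 < hyperbolicWeight C₂ S₂ C₁ S₁ C₃ S₃ b a c :=
  h.swap₁₂.weight₁_pos (h.height₂_pos hH)

theorem weight₃_pos (h : IsCircleTriple C₁ S₁ C₂ S₂ C₃ S₃ a b c)
    (hH : hyperbolicHeight C₁ S₁ C₂ S₂ C₃ S₃ a b c ≤ 0) :
    0 < hyperbolicWeight C₃ S₃ C₁ S₁ C₂ S₂ c a b :=
  h.swap₂₃.swap₁₂.weight₁_pos (h.height₃_pos hH)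

/-- In `hyperbolic_form_det` the factors `Cⱼ * cᵢ - Cₖ` are the partial derivatives of the side
cosines in the conformal coordinates. Each is a hyperbolic sine times a factor from
`length_det_pos`, so the determinant is positive whichever signs the weights have. -/
theorem det_pos (h : IsCircleTriple C₁ S₁ C₂ S₂ C₃ S₃ a b c) {c₁ c₂ c₃ w₁ w₂ w₃ : ℝ}
    (e₁ : c₁ = C₂ * C₃ + a * (S₂ * S₃)) (e₂ : c₂ = C₁ * C₃ + b * (S₁ * S₃))
    (e₃ : c₃ = C₁ * C₂ + c * (S₁ * S₂))
    (f₁ : w₁ = hyperbolicWeight C₁ S₁ C₂ S₂ C₃ S₃ a b c)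
    (f₂ : w₂ = hyperbolicWeight C₂ S₂ C₁ S₁ C₃ S₃ b a c)
    (f₃ : w₃ = hyperbolicWeight C₃ S₃ C₁ S₁ C₂ S₂ c a b)
    (hW : 0 < hyperbolicGram c₁ c₂ c₃) :
    0 < w₁ ^ 2 * (c₁ ^ 2 - 1) * (w₂ * c₂ + w₃ * c₃) + w₂ ^ 2 * (c₂ ^ 2 - 1) * (w₁ * c₁ + w₃ * c₃)
      + w₃ ^ 2 * (c₃ ^ 2 - 1) * (w₁ * c₁ + w₂ * c₂)
      + 2 * w₁ * w₂ * w₃ * (c₁ * c₂ * c₃ - 1) := by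
  have p₁ : 0 < c₁ ^ 2 - 1 := by rw [e₁]; exact h.sq_c₁_sub_one_pos
  have p₂ : 0 < c₂ ^ 2 - 1 := by rw [e₂]; exact h.sq_c₂_sub_one_pos
  have p₃ : 0 < c₃ ^ 2 - 1 := by rw [e₃]; exact h.sq_c₃_sub_one_pos
  have := h.S₁_pos; have := h.S₂_pos; have := h.S₃_pos
  rw [hyperbolic_form_det (C₁ := C₁) (C₂ := C₂) (C₃ := C₃) p₁.ne' p₂.ne' p₃.ne']
  · refine div_pos (mul_pos (pow_pos hW 2) ?_) (by positivity)
    have hD := length_det_pos h.a_gt h.b_gt h.c_gt h.γ₁ h.γ₂ h.γ₃ h.S₁_pos h.S₂_pos h.S₃_pos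
      h.C₁_pos h.C₂_pos h.C₃_pos
    have aux : ∀ {C D S T I : ℝ}, C ^ 2 = S ^ 2 + 1 →
        C * (C * D + I * (S * T)) - D = S * (S * D + I * (C * T)) := by
      intro C D S T I hC
      linear_combination D * hC
    have g1 : C₂ * c₁ - C₃ = S₂ * (S₂ * C₃ + a * (C₂ * S₃)) := by rw [e₁]; exact aux h.sq₂
    have g2 : C₃ * c₂ - C₁ = S₃ * (S₃ * C₁ + b * (C₃ * S₁)) := by
      rw [e₂, mul_comm C₁ C₃, mul_comm S₁ S₃]; exact aux h.sq₃
    have g3 : C₁ * c₃ - C₂ = S₁ * (S₁ * C₂ + c * (C₁ * S₂)) := by rw [e₃]; exact aux h.sq₁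
    have g4 : C₃ * c₁ - C₂ = S₃ * (S₃ * C₂ + a * (C₃ * S₂)) := by
      rw [e₁, mul_comm C₂ C₃, mul_comm S₂ S₃]; exact aux h.sq₃
    have g5 : C₁ * c₂ - C₃ = S₁ * (S₁ * C₃ + b * (C₁ * S₃)) := by rw [e₂]; exact aux h.sq₁
    have g6 : C₂ * c₃ - C₁ = S₂ * (S₂ * C₁ + c * (C₂ * S₁)) := by
      rw [e₃, mul_comm C₁ C₂, mul_comm S₁ S₂]; exact aux h.sq₂
    rw [g1, g2, g3, g4, g5, g6]
    have := mul_pos (mul_pos (mul_pos h.S₁_pos h.S₂_pos) h.S₃_pos) hD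
    linarith
  · rw [f₁, e₁, e₂, e₃, hyperbolicWeight, hyperbolicHeight, ← hyperbolic_weight_eq h.sq₂ h.sq₃]
  · have := hyperbolic_weight_eq (a := b) (b := a) (c := c) (C₁ := C₂) (S₁ := S₂) h.sq₁ h.sq₃
    rw [f₂, e₁, e₂, e₃, hyperbolicWeight, hyperbolicHeight, ← this]
    congr 1; ring
  · have := hyperbolic_weight_eq (a := c) (b := a) (c := b) (C₁ := C₃) (S₁ := S₃) h.sq₁ h.sq₂
    rw [f₃, e₁, e₂, e₃, hyperbolicWeight, hyperbolicHeight, ← this]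
    congr 1; ring

/-- If the first signed height vanishes then the first principal `2 × 2` minor is positive. -/
theorem minor_pos_of_height_eq_zero (h : IsCircleTriple C₁ S₁ C₂ S₂ C₃ S₃ a b c)
    (hH : hyperbolicHeight C₁ S₁ C₂ S₂ C₃ S₃ a b c = 0) :
    0 < hyperbolicMinor C₁ S₁ C₂ S₂ C₃ S₃ a b c := by
  have w1 : hyperbolicWeight C₁ S₁ C₂ S₂ C₃ S₃ a b c = 0 := by
    rw [hyperbolicWeight, hH]; simp
  have w2 := h.weight₂_pos hH.le
  have w3 := h.weight₃_pos hH.le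
  have c2 := h.one_lt_c₂
  have c3 := h.one_lt_c₃
  unfold hyperbolicMinor
  rw [w1]
  set w₂ := hyperbolicWeight C₂ S₂ C₁ S₁ C₃ S₃ b a c
  set w₃ := hyperbolicWeight C₃ S₃ C₁ S₁ C₂ S₂ c a b
  set c₂ := C₁ * C₃ + b * (S₁ * S₃)
  set c₃ := C₁ * C₂ + c * (S₁ * S₂)
  have e : (w₃ * c₃ + w₂ * c₂) * (w₃ * c₃ + 0 * (C₂ * C₃ + a * (S₂ * S₃))) - w₃ ^ 2
      = w₃ ^ 2 * (c₃ - 1) * (c₃ + 1) + w₂ * w₃ * c₂ * c₃ := by ring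
  rw [e]
  have := sub_pos.mpr c3
  have : 0 < c₂ := by linarith
  have : 0 < c₃ := by linarith
  positivity

/-- By the Desnanot–Jacobi identity, the first diagonal entry times the determinant is the product
of two `2 × 2` principal minors minus a square. Were this minor zero, the positive determinant would
be at most zero. -/
theorem minor_ne_zero (h : IsCircleTriple C₁ S₁ C₂ S₂ C₃ S₃ a b c)
    (hH : hyperbolicHeight C₁ S₁ C₂ S₂ C₃ S₃ a b c ≤ 0)
    (hW : 0 < hyperbolicGram (C₂ * C₃ + a * (S₂ * S₃)) (C₁ * C₃ + b * (S₁ * S₃))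
      (C₁ * C₂ + c * (S₁ * S₂))) :
    hyperbolicMinor C₁ S₁ C₂ S₂ C₃ S₃ a b c ≠ 0 := by
  intro h0
  have hdet := h.det_pos rfl rfl rfl rfl rfl rfl hW
  have w2 := h.weight₂_pos hH
  have w3 := h.weight₃_pos hH
  have c2 := h.one_lt_c₂
  have c3 := h.one_lt_c₃
  unfold hyperbolicMinor at h0
  set w₁ := hyperbolicWeight C₁ S₁ C₂ S₂ C₃ S₃ a b c
  set w₂ := hyperbolicWeight C₂ S₂ C₁ S₁ C₃ S₃ b a c
  set w₃ := hyperbolicWeight C₃ S₃ C₁ S₁ C₂ S₂ c a b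
  set c₁ := C₂ * C₃ + a * (S₂ * S₃)
  set c₂ := C₁ * C₃ + b * (S₁ * S₃)
  set c₃ := C₁ * C₂ + c * (S₁ * S₂)
  have hA : 0 < w₃ * c₃ + w₂ * c₂ := by
    have : 0 < c₂ := by linarith
    have : 0 < c₃ := by linarith
    positivity
  have key : (w₃ * c₃ + w₂ * c₂) *
      (w₁ ^ 2 * (c₁ ^ 2 - 1) * (w₂ * c₂ + w₃ * c₃) + w₂ ^ 2 * (c₂ ^ 2 - 1) * (w₁ * c₁ + w₃ * c₃)
        + w₃ ^ 2 * (c₃ ^ 2 - 1) * (w₁ * c₁ + w₂ * c₂)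
        + 2 * w₁ * w₂ * w₃ * (c₁ * c₂ * c₃ - 1))
      = ((w₃ * c₃ + w₂ * c₂) * (w₃ * c₃ + w₁ * c₁) - w₃ ^ 2)
        * ((w₃ * c₃ + w₂ * c₂) * (w₂ * c₂ + w₁ * c₁) - w₂ ^ 2)
        - ((w₃ * c₃ + w₂ * c₂) * w₁ + w₂ * w₃) ^ 2 := by ring
  rw [h0, zero_mul, zero_sub] at key
  have hpos := mul_pos hA hdet
  rw [key] at hpos
  exact absurd hpos (not_lt.mpr (neg_nonpos.mpr (sq_nonneg _)))

theorem continuousOn_weight {f₁ f₂ f₃ : ℝ → ℝ} {s : Set ℝ} (h₁ : ContinuousOn f₁ s)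
    (h₂ : ContinuousOn f₂ s) (h₃ : ContinuousOn f₃ s)
    (h : ∀ τ ∈ s, 1 < C₂ * C₃ + f₁ τ * (S₂ * S₃)) :
    ContinuousOn (fun τ => hyperbolicWeight C₁ S₁ C₂ S₂ C₃ S₃ (f₁ τ) (f₂ τ) (f₃ τ)) s := by
  unfold hyperbolicWeight hyperbolicHeight
  refine ContinuousOn.div (by fun_prop) (by fun_prop) fun τ hτ => ?_
  exact (sub_pos.mpr (one_lt_pow₀ (h τ hτ) two_ne_zero)).ne'

theorem continuousOn_minor {f₂ f₃ : ℝ → ℝ} {s : Set ℝ}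
    (h₂ : ContinuousOn f₂ s) (h₃ : ContinuousOn f₃ s)
    (h : ∀ τ ∈ s, IsCircleTriple C₁ S₁ C₂ S₂ C₃ S₃ a (f₂ τ) (f₃ τ)) :
    ContinuousOn (fun τ => hyperbolicMinor C₁ S₁ C₂ S₂ C₃ S₃ a (f₂ τ) (f₃ τ)) s := by
  have w1 : ContinuousOn (fun τ => hyperbolicWeight C₁ S₁ C₂ S₂ C₃ S₃ a (f₂ τ) (f₃ τ)) s :=
    continuousOn_weight continuousOn_const h₂ h₃ fun τ hτ => (h τ hτ).one_lt_c₁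
  have w2 : ContinuousOn (fun τ => hyperbolicWeight C₂ S₂ C₁ S₁ C₃ S₃ (f₂ τ) a (f₃ τ)) s :=
    continuousOn_weight h₂ continuousOn_const h₃ fun τ hτ => (h τ hτ).one_lt_c₂
  have w3 : ContinuousOn (fun τ => hyperbolicWeight C₃ S₃ C₁ S₁ C₂ S₂ (f₃ τ) a (f₂ τ)) s :=
    continuousOn_weight h₃ continuousOn_const h₂ fun τ hτ => (h τ hτ).one_lt_c₃
  have l2 : ContinuousOn (fun τ => C₁ * C₃ + f₂ τ * (S₁ * S₃)) s := by fun_prop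
  have l3 : ContinuousOn (fun τ => C₁ * C₂ + f₃ τ * (S₁ * S₂)) s := by fun_prop
  unfold hyperbolicMinor
  exact (((w3.mul l3).add (w2.mul l2)).mul
    ((w3.mul l3).add (w1.mul continuousOn_const))).sub (w3.pow 2)

/-- If the first signed height is nonpositive then the first principal `2 × 2` minor is positive:
increasing `b` and `c` deforms the triangle to one whose first height vanishes. -/
theorem minor_pos (h : IsCircleTriple C₁ S₁ C₂ S₂ C₃ S₃ a b c)
    (hH : hyperbolicHeight C₁ S₁ C₂ S₂ C₃ S₃ a b c ≤ 0)
    (hW : 0 < hyperbolicGram (C₂ * C₃ + a * (S₂ * S₃)) (C₁ * C₃ + b * (S₁ * S₃))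
      (C₁ * C₂ + c * (S₁ * S₂))) :
    0 < hyperbolicMinor C₁ S₁ C₂ S₂ C₃ S₃ a b c := by
  rcases hH.eq_or_lt with hH0 | hH0
  · exact h.minor_pos_of_height_eq_zero hH0
  have hC₁ := h.C₁_pos; have hC₂ := h.C₂_pos; have hC₃ := h.C₃_pos
  have hS₁ := h.S₁_pos; have hS₂ := h.S₂_pos; have hS₃ := h.S₃_pos
  have ha := h.a_gt
  have hP₁ : 0 < C₁ * (S₂ * S₃) := by positivity
  have hP₂ : 0 < C₂ * (S₁ * S₃) := by positivity
  have hP₃ : 0 < C₃ * (S₁ * S₂) := by positivity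
  -- Only the term with `1 - a ^ 2` can make the height negative.
  have ha1 : 1 < a := by
    by_contra! h'
    have e1 : 0 ≤ C₁ * (S₂ * S₃) * (1 - a ^ 2) := mul_nonneg hP₁.le (by nlinarith)
    have e2 := mul_nonneg hP₂.le h.γ₃
    have e3 := mul_nonneg hP₃.le h.γ₂
    unfold hyperbolicHeight at hH0
    linarith
  -- `γ₂` and `γ₃` add up to `(1 + a) * (b + c)`. The sign of `b + c` keeps `γ₁` true along the
  -- deformation and is also needed for the growth of the Gram determinant.
  have hbc : 0 ≤ b + c := by
    refine nonneg_of_mul_nonneg_right (a := 1 + a) ?_ (by linarith)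
    linarith [h.γ₂, h.γ₃]
  set d : ℝ := (1 + a) * (C₂ * (S₁ * S₃) + C₃ * (S₁ * S₂)) with hd
  have hd0 : 0 < d := mul_pos (by linarith) (by linarith)
  have hHτ : ∀ τ, hyperbolicHeight C₁ S₁ C₂ S₂ C₃ S₃ a (b + τ) (c + τ)
      = hyperbolicHeight C₁ S₁ C₂ S₂ C₃ S₃ a b c + τ * d := by
    intro τ; rw [hd]; unfold hyperbolicHeight; ring
  -- The height is affine in `τ` with slope `d`, and `T` is its zero.
  set T : ℝ := -hyperbolicHeight C₁ S₁ C₂ S₂ C₃ S₃ a b c / d with hT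
  have hTd : T * d = -hyperbolicHeight C₁ S₁ C₂ S₂ C₃ S₃ a b c := div_mul_cancel₀ _ hd0.ne'
  have hT0 : 0 < T := div_pos (by linarith) hd0
  have hle : ∀ τ ∈ Set.Icc 0 T, hyperbolicHeight C₁ S₁ C₂ S₂ C₃ S₃ a (b + τ) (c + τ) ≤ 0 := by
    intro τ hτ
    have := mul_le_mul_of_nonneg_right hτ.2 hd0.le
    rw [hHτ]; linarith
  have htri : ∀ τ ∈ Set.Icc 0 T, IsCircleTriple C₁ S₁ C₂ S₂ C₃ S₃ a (b + τ) (c + τ) := by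
    intro τ hτ
    have h1 : 0 ≤ τ * (b + c) + τ ^ 2 := add_nonneg (mul_nonneg hτ.1 hbc) (sq_nonneg _)
    have h2 : 0 ≤ τ * (1 + a) := mul_nonneg hτ.1 (by linarith)
    exact ⟨h.sq₁, h.sq₂, h.sq₃, hC₁, hC₂, hC₃, hS₁, hS₂, hS₃, ha, by linarith [h.b_gt, hτ.1],
      by linarith [h.c_gt, hτ.1], by linarith [h.γ₁], by linarith [h.γ₂], by linarith [h.γ₃]⟩
  have hWτ : ∀ τ ∈ Set.Icc 0 T, 0 < hyperbolicGram (C₂ * C₃ + a * (S₂ * S₃))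
      (C₁ * C₃ + (b + τ) * (S₁ * S₃)) (C₁ * C₂ + (c + τ) * (S₁ * S₂)) := by
    intro τ hτ
    refine hW.trans_le ?_
    unfold hyperbolicGram
    rw [hyperbolic_gram_eq h.sq₁ h.sq₂ h.sq₃, hyperbolic_gram_eq h.sq₁ h.sq₂ h.sq₃]
    exact hyperbolic_gram_mono ha1 hbc hP₂ hP₃ hτ.1 (hle τ hτ)
  have hMT := (htri T ⟨hT0.le, le_rfl⟩).minor_pos_of_height_eq_zero (by rw [hHτ, hTd]; ring)
  by_contra! hneg
  -- The minor is positive at `T` and vanishes nowhere on `[0, T]`, because the Gram determinant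
  -- stays positive there. A nonpositive value at `0` would contradict the intermediate value
  -- theorem.
  have hMc := continuousOn_minor (f₂ := fun τ => b + τ) (f₃ := fun τ => c + τ) (s := Set.Icc 0 T)
    (by fun_prop) (by fun_prop) htri
  obtain ⟨τ, hτ, h0⟩ := intermediate_value_Icc hT0.le hMc ⟨by simpa using hneg, hMT.le⟩
  exact (htri τ hτ).minor_ne_zero (hle τ hτ) (hWτ τ hτ) h0

theorem form_pos_of_height_nonpos (h : IsCircleTriple C₁ S₁ C₂ S₂ C₃ S₃ a b c) {c₁ c₂ c₃ : ℝ}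
    (e₁ : c₁ = C₂ * C₃ + a * (S₂ * S₃)) (e₂ : c₂ = C₁ * C₃ + b * (S₁ * S₃))
    (e₃ : c₃ = C₁ * C₂ + c * (S₁ * S₂)) (hW : 0 < hyperbolicGram c₁ c₂ c₃)
    (hH : hyperbolicHeight C₁ S₁ C₂ S₂ C₃ S₃ a b c ≤ 0) {v₁ v₂ v₃ : ℝ}
    (hv : ¬ (v₁ = 0 ∧ v₂ = 0 ∧ v₃ = 0)) :
    0 < hyperbolicForm (hyperbolicWeight C₁ S₁ C₂ S₂ C₃ S₃ a b c)
      (hyperbolicWeight C₂ S₂ C₁ S₁ C₃ S₃ b a c) (hyperbolicWeight C₃ S₃ C₁ S₁ C₂ S₂ c a b)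
      c₁ c₂ c₃ v₁ v₂ v₃ := by
  have hM := h.minor_pos hH (by rwa [← e₁, ← e₂, ← e₃])
  rw [hyperbolicMinor, ← e₁, ← e₂, ← e₃] at hM
  refine hyperbolic_form_pos_of_minors ?_ hM (h.det_pos e₁ e₂ e₃ rfl rfl rfl hW) hv
  have w2 := h.weight₂_pos hH
  have w3 := h.weight₃_pos hH
  have : 0 < c₂ := by linarith [h.one_lt_c₂]
  have : 0 < c₃ := by linarith [h.one_lt_c₃]
  positivity

/-- The variation of the angles of a hyperbolic triangle of circles is negative definite. -/
theorem form_pos (h : IsCircleTriple C₁ S₁ C₂ S₂ C₃ S₃ a b c) {c₁ c₂ c₃ : ℝ}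
    (e₁ : c₁ = C₂ * C₃ + a * (S₂ * S₃)) (e₂ : c₂ = C₁ * C₃ + b * (S₁ * S₃))
    (e₃ : c₃ = C₁ * C₂ + c * (S₁ * S₂)) (hW : 0 < hyperbolicGram c₁ c₂ c₃) {v₁ v₂ v₃ : ℝ}
    (hv : ¬ (v₁ = 0 ∧ v₂ = 0 ∧ v₃ = 0)) :
    0 < hyperbolicForm (hyperbolicWeight C₁ S₁ C₂ S₂ C₃ S₃ a b c)
      (hyperbolicWeight C₂ S₂ C₁ S₁ C₃ S₃ b a c) (hyperbolicWeight C₃ S₃ C₁ S₁ C₂ S₂ c a b)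
      c₁ c₂ c₃ v₁ v₂ v₃ := by
  rcases le_or_gt (hyperbolicHeight C₁ S₁ C₂ S₂ C₃ S₃ a b c) 0 with k₁ | k₁
  · exact h.form_pos_of_height_nonpos e₁ e₂ e₃ hW k₁ hv
  rcases le_or_gt (hyperbolicHeight C₂ S₂ C₁ S₁ C₃ S₃ b a c) 0 with k₂ | k₂
  · have := h.swap₁₂.form_pos_of_height_nonpos (c₃ := c₃) (v₁ := v₂) (v₂ := v₁) (v₃ := v₃) e₂ e₁
      (by rw [e₃]; ring) (by unfold hyperbolicGram at hW ⊢; linarith) k₂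
      (fun h => hv ⟨h.2.1, h.1, h.2.2⟩)
    rw [weight_swap₂₃ (C₁ := C₃)] at this
    unfold hyperbolicForm at this ⊢
    linarith
  rcases le_or_gt (hyperbolicHeight C₃ S₃ C₁ S₁ C₂ S₂ c a b) 0 with k₃ | k₃
  · have := h.swap₂₃.swap₁₂.form_pos_of_height_nonpos (c₂ := c₁) (c₃ := c₂)
      (v₁ := v₃) (v₂ := v₁) (v₃ := v₂) e₃
      (by rw [e₁]; ring) (by rw [e₂]; ring)
      (by unfold hyperbolicGram at hW ⊢; linarith) k₃
      (fun h => hv ⟨h.2.1, h.2.2, h.1⟩)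
    rw [weight_swap₂₃ (C₁ := C₁), weight_swap₂₃ (C₁ := C₂)] at this
    unfold hyperbolicForm at this ⊢
    linarith
  · exact hyperbolic_form_pos_of_weights (h.weight₁_nonneg k₁.le) (h.swap₁₂.weight₁_pos k₂)
      (h.swap₂₃.swap₁₂.weight₁_pos k₃) (by rw [e₁]; exact h.one_lt_c₁)
      (by rw [e₂]; exact h.one_lt_c₂) (by rw [e₃]; exact h.one_lt_c₃) hv

end IsCircleTriple

/-! ### Weighted angle sums along a path -/

/-- Along a path of triangles, possibly degenerate in between, for which the weighted sum of the
angles has negative derivative at nondegenerate triangles, this weighted sum decreases. The angles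
are given by laws of cosines `cos θᵢ = Nᵢ / √(pⱼ pₖ)` with common Gram determinant `W`. -/
theorem weighted_angle_sum_lt {N₁ N₂ N₃ p₁ p₂ p₃ W : ℝ → ℝ} {v₁ v₂ v₃ : ℝ}
    (hp : ∀ t ∈ Set.Icc (0 : ℝ) 1, 0 < p₁ t ∧ 0 < p₂ t ∧ 0 < p₃ t)
    (hd : ∀ t ∈ Set.Icc (0 : ℝ) 1, ∃ N₁' N₂' N₃' p₁' p₂' p₃' : ℝ,
      HasDerivAt N₁ N₁' t ∧ HasDerivAt N₂ N₂' t ∧ HasDerivAt N₃ N₃' t ∧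
      HasDerivAt p₁ p₁' t ∧ HasDerivAt p₂ p₂' t ∧ HasDerivAt p₃ p₃' t ∧
      (0 < W t → 0 < v₁ * (N₁' - N₁ t * (p₂' / (2 * p₂ t) + p₃' / (2 * p₃ t)))
        + v₂ * (N₂' - N₂ t * (p₁' / (2 * p₁ t) + p₃' / (2 * p₃ t)))
        + v₃ * (N₃' - N₃ t * (p₁' / (2 * p₁ t) + p₂' / (2 * p₂ t)))))
    (hW₁ : ∀ t, p₂ t * p₃ t - N₁ t ^ 2 = W t) (hW₂ : ∀ t, p₁ t * p₃ t - N₂ t ^ 2 = W t)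
    (hW₃ : ∀ t, p₁ t * p₂ t - N₃ t ^ 2 = W t) (hW0 : 0 < W 0) :
    v₁ * Real.arccos (N₁ 1 / √(p₂ 1 * p₃ 1)) + v₂ * Real.arccos (N₂ 1 / √(p₁ 1 * p₃ 1))
        + v₃ * Real.arccos (N₃ 1 / √(p₁ 1 * p₂ 1))
      < v₁ * Real.arccos (N₁ 0 / √(p₂ 0 * p₃ 0)) + v₂ * Real.arccos (N₂ 0 / √(p₁ 0 * p₃ 0))
        + v₃ * Real.arccos (N₃ 0 / √(p₁ 0 * p₂ 0)) := by
  have cN₁ : ContinuousOn N₁ (Set.Icc 0 1) := fun t ht => by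
    obtain ⟨_, _, _, _, _, _, h, _⟩ := hd t ht; exact h.continuousAt.continuousWithinAt
  have cN₂ : ContinuousOn N₂ (Set.Icc 0 1) := fun t ht => by
    obtain ⟨_, _, _, _, _, _, _, h, _⟩ := hd t ht; exact h.continuousAt.continuousWithinAt
  have cN₃ : ContinuousOn N₃ (Set.Icc 0 1) := fun t ht => by
    obtain ⟨_, _, _, _, _, _, _, _, h, _⟩ := hd t ht; exact h.continuousAt.continuousWithinAt
  have cp₁ : ContinuousOn p₁ (Set.Icc 0 1) := fun t ht => by
    obtain ⟨_, _, _, _, _, _, _, _, _, h, _⟩ := hd t ht; exact h.continuousAt.continuousWithinAt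
  have cp₂ : ContinuousOn p₂ (Set.Icc 0 1) := fun t ht => by
    obtain ⟨_, _, _, _, _, _, _, _, _, _, h, _⟩ := hd t ht; exact h.continuousAt.continuousWithinAt
  have cp₃ : ContinuousOn p₃ (Set.Icc 0 1) := fun t ht => by
    obtain ⟨_, _, _, _, _, _, _, _, _, _, _, h, _⟩ := hd t ht
    exact h.continuousAt.continuousWithinAt
  have cA : ∀ {N p q : ℝ → ℝ}, ContinuousOn N (Set.Icc 0 1) → ContinuousOn p (Set.Icc 0 1) →
      ContinuousOn q (Set.Icc 0 1) → (∀ t ∈ Set.Icc (0 : ℝ) 1, 0 < p t ∧ 0 < q t) →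
      ContinuousOn (fun t => Real.arccos (N t / √(p t * q t))) (Set.Icc 0 1) := by
    intro N p q hN hp hq h
    refine Real.continuous_arccos.comp_continuousOn (hN.div (hp.mul hq).sqrt fun t ht => ?_)
    exact (Real.sqrt_pos.mpr (mul_pos (h t ht).1 (h t ht).2)).ne'
  have cW : ContinuousOn W (Set.Icc 0 1) :=
    ((cp₂.mul cp₃).sub (cN₁.pow 2)).congr fun t _ => (hW₁ t).symm
  -- Where `W ≤ 0` each angle lies in `B`, so the weighted sum lies in the finite image of `B ×ˢ B
  -- ×ˢ B`. Which of the angles are `π` is irrelevant.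
  set B : Set ℝ := {0, Real.pi} with hB
  have hBf : B.Finite := by rw [hB]; exact Set.toFinite _
  refine lt_of_deriv_neg_of_finite_values (W := W)
    (f := fun t => v₁ * Real.arccos (N₁ t / √(p₂ t * p₃ t))
      + v₂ * Real.arccos (N₂ t / √(p₁ t * p₃ t)) + v₃ * Real.arccos (N₃ t / √(p₁ t * p₂ t)))
    (A := (fun x : ℝ × ℝ × ℝ => v₁ * x.1 + v₂ * x.2.1 + v₃ * x.2.2) '' (B ×ˢ B ×ˢ B))
    ((hBf.prod (hBf.prod hBf)).image _) ?_ cW hW0 ?_ ?_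
  · exact ((continuousOn_const.mul (cA cN₁ cp₂ cp₃ fun t ht => ⟨(hp t ht).2.1, (hp t ht).2.2⟩)).add
      (continuousOn_const.mul (cA cN₂ cp₁ cp₃ fun t ht => ⟨(hp t ht).1, (hp t ht).2.2⟩))).add
      (continuousOn_const.mul (cA cN₃ cp₁ cp₂ fun t ht => ⟨(hp t ht).1, (hp t ht).2.1⟩))
  · intro t ht hWt
    obtain ⟨q₁, q₂, q₃⟩ := hp t ht
    exact ⟨(_, _, _), ⟨arccos_div_sqrt_degenerate (mul_pos q₂ q₃) (by rw [hW₁]; exact hWt),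
      arccos_div_sqrt_degenerate (mul_pos q₁ q₃) (by rw [hW₂]; exact hWt),
      arccos_div_sqrt_degenerate (mul_pos q₁ q₂) (by rw [hW₃]; exact hWt)⟩, rfl⟩
  · intro t ht hWt
    have ht' : t ∈ Set.Icc (0 : ℝ) 1 := ⟨ht.1.le, ht.2.le⟩
    obtain ⟨q₁, q₂, q₃⟩ := hp t ht'
    obtain ⟨N₁', N₂', N₃', p₁', p₂', p₃', dN₁, dN₂, dN₃, dp₁, dp₂, dp₃, hpos⟩ := hd t ht'
    have d₁ := dN₁.arccos_div_sqrt dp₂ dp₃ q₂ q₃ (by rw [hW₁]; exact hWt)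
    have d₂ := dN₂.arccos_div_sqrt dp₁ dp₃ q₁ q₃ (by rw [hW₂]; exact hWt)
    have d₃ := dN₃.arccos_div_sqrt dp₁ dp₂ q₁ q₂ (by rw [hW₃]; exact hWt)
    refine ⟨_, ?_, ((d₁.const_mul v₁).add (d₂.const_mul v₂)).add (d₃.const_mul v₃)⟩
    rw [hW₁, hW₂, hW₃]
    have hs : 0 < √(W t) := Real.sqrt_pos.mpr hWt
    have := div_pos (hpos hWt) hs
    rw [← neg_pos]
    refine this.trans_eq ?_
    ring

theorem HasDerivAt.sq_length {X Y : ℝ → ℝ} {v w t : ℝ} (I : ℝ) (hX : HasDerivAt X (v * X t) t)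
    (hY : HasDerivAt Y (w * Y t) t) :
    HasDerivAt (fun τ => X τ ^ 2 + Y τ ^ 2 + 2 * X τ * Y τ * I)
      (2 * (v * X t ^ 2 + w * Y t ^ 2) + 2 * X t * Y t * I * (v + w)) t := by
  refine (((hX.pow 2).add (hY.pow 2)).add (((hX.const_mul 2).mul hY).mul_const I)).congr_deriv ?_
  simp
  ring

/-- The left side is `-√W` times the derivative of the weighted angle sum. Both the `sᵢ'` and the
heights can be written through the `sᵢ` and the squared radii, which eliminates the inversive
distances and leaves a rational identity. -/
theorem euclidean_variation_eq {a b c x y z s₁ s₂ s₃ v₁ v₂ v₃ s₁' s₂' s₃' : ℝ}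
    (hs₁ : s₁ = y ^ 2 + z ^ 2 + 2 * y * z * a) (hs₂ : s₂ = x ^ 2 + z ^ 2 + 2 * x * z * b)
    (hs₃ : s₃ = x ^ 2 + y ^ 2 + 2 * x * y * c) (p₁ : s₁ ≠ 0) (p₂ : s₂ ≠ 0) (p₃ : s₃ ≠ 0)
    (h₁ : s₁' = 2 * (v₂ * y ^ 2 + v₃ * z ^ 2) + 2 * y * z * a * (v₂ + v₃))
    (h₂ : s₂' = 2 * (v₁ * x ^ 2 + v₃ * z ^ 2) + 2 * x * z * b * (v₁ + v₃))
    (h₃ : s₃' = 2 * (v₁ * x ^ 2 + v₂ * y ^ 2) + 2 * x * y * c * (v₁ + v₂)) :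
    v₁ * ((s₂' + s₃' - s₁') / 2 - (s₂ + s₃ - s₁) / 2 * (s₂' / (2 * s₂) + s₃' / (2 * s₃)))
      + v₂ * ((s₁' + s₃' - s₂') / 2 - (s₁ + s₃ - s₂) / 2 * (s₁' / (2 * s₁) + s₃' / (2 * s₃)))
      + v₃ * ((s₁' + s₂' - s₃') / 2 - (s₁ + s₂ - s₃) / 2 * (s₁' / (2 * s₁) + s₂' / (2 * s₂)))
    = y * z * (y * z * (1 - a ^ 2) + x * z * (c + a * b) + x * y * (b + a * c)) / s₁
          * (v₂ - v₃) ^ 2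
      + x * z * (x * z * (1 - b ^ 2) + y * z * (c + a * b) + x * y * (a + b * c)) / s₂
          * (v₁ - v₃) ^ 2
      + x * y * (x * y * (1 - c ^ 2) + y * z * (b + a * c) + x * z * (a + b * c)) / s₃
          * (v₁ - v₂) ^ 2 := by
  have e₁ : s₁' = v₂ * (s₁ + y ^ 2 - z ^ 2) + v₃ * (s₁ + z ^ 2 - y ^ 2) := by
    rw [h₁, hs₁]; ring
  have e₂ : s₂' = v₁ * (s₂ + x ^ 2 - z ^ 2) + v₃ * (s₂ + z ^ 2 - x ^ 2) := by
    rw [h₂, hs₂]; ring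
  have e₃ : s₃' = v₁ * (s₃ + x ^ 2 - y ^ 2) + v₂ * (s₃ + y ^ 2 - x ^ 2) := by
    rw [h₃, hs₃]; ring
  have g₁ : y * z * (y * z * (1 - a ^ 2) + x * z * (c + a * b) + x * y * (b + a * c))
      = (s₁ * (s₂ + s₃ - s₁) + y ^ 2 * (s₁ + s₂ - s₃) + z ^ 2 * (s₁ + s₃ - s₂)
        - 2 * x ^ 2 * s₁) / 4 := by
    rw [hs₁, hs₂, hs₃]; ring
  have g₂ : x * z * (x * z * (1 - b ^ 2) + y * z * (c + a * b) + x * y * (a + b * c))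
      = (s₂ * (s₁ + s₃ - s₂) + x ^ 2 * (s₁ + s₂ - s₃) + z ^ 2 * (s₂ + s₃ - s₁)
        - 2 * y ^ 2 * s₂) / 4 := by
    rw [hs₁, hs₂, hs₃]; ring
  have g₃ : x * y * (x * y * (1 - c ^ 2) + y * z * (b + a * c) + x * z * (a + b * c))
      = (s₃ * (s₁ + s₂ - s₃) + x ^ 2 * (s₁ + s₃ - s₂) + y ^ 2 * (s₂ + s₃ - s₁)
        - 2 * z ^ 2 * s₃) / 4 := by
    rw [hs₁, hs₂, hs₃]; ring
  rw [g₁, g₂, g₃, e₁, e₂, e₃]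
  field_simp
  ring

/-- Once each `cᵢ'` is expressed by side cosines and the `Cᵢ` alone, neither the inversive distances
nor the `Sᵢ` occur, and the identity is purely rational. -/
theorem hyperbolic_variation_eq {c₁ c₂ c₃ C₁ C₂ C₃ v₁ v₂ v₃ c₁' c₂' c₃' : ℝ}
    (p₁ : c₁ ^ 2 - 1 ≠ 0) (p₂ : c₂ ^ 2 - 1 ≠ 0) (p₃ : c₃ ^ 2 - 1 ≠ 0)
    (h₁ : c₁' = v₂ * (C₂ * c₁ - C₃) + v₃ * (C₃ * c₁ - C₂))
    (h₂ : c₂' = v₁ * (C₁ * c₂ - C₃) + v₃ * (C₃ * c₂ - C₁))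
    (h₃ : c₃' = v₁ * (C₁ * c₃ - C₂) + v₂ * (C₂ * c₃ - C₁)) :
    v₁ * ((c₂' * c₃ + c₂ * c₃' - c₁') - (c₂ * c₃ - c₁) *
          (2 * c₂ * c₂' / (2 * (c₂ ^ 2 - 1)) + 2 * c₃ * c₃' / (2 * (c₃ ^ 2 - 1))))
      + v₂ * ((c₁' * c₃ + c₁ * c₃' - c₂') - (c₁ * c₃ - c₂) *
          (2 * c₁ * c₁' / (2 * (c₁ ^ 2 - 1)) + 2 * c₃ * c₃' / (2 * (c₃ ^ 2 - 1))))
      + v₃ * ((c₁' * c₂ + c₁ * c₂' - c₃') - (c₁ * c₂ - c₃) *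
          (2 * c₁ * c₁' / (2 * (c₁ ^ 2 - 1)) + 2 * c₂ * c₂' / (2 * (c₂ ^ 2 - 1))))
    = hyperbolicForm
      ((C₂ * (c₁ * c₂ - c₃) + C₃ * (c₁ * c₃ - c₂) - C₁ * (c₁ ^ 2 - 1)) / (c₁ ^ 2 - 1))
      ((C₁ * (c₁ * c₂ - c₃) + C₃ * (c₂ * c₃ - c₁) - C₂ * (c₂ ^ 2 - 1)) / (c₂ ^ 2 - 1))
      ((C₁ * (c₁ * c₃ - c₂) + C₂ * (c₂ * c₃ - c₁) - C₃ * (c₃ ^ 2 - 1)) / (c₃ ^ 2 - 1))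
      c₁ c₂ c₃ v₁ v₂ v₃ := by
  rw [h₁, h₂, h₃, hyperbolicForm]
  field_simp
  ring

theorem sq_length_pos {x y I : ℝ} (hx : 0 < x) (hy : 0 < y) (hI : -1 < I) :
    0 < x ^ 2 + y ^ 2 + 2 * x * y * I := by
  have := mul_pos (mul_pos hx hy) (neg_lt_iff_pos_add'.mp hI)
  nlinarith [sq_nonneg (x - y)]

/-- Strict monotonicity of the angles of a Euclidean triangle of circles with fixed inversive
distances, as functions of the logarithms of the radii; the second triangle may degenerate. -/
theorem euclidean_triangle_monotone {a b c x y z v₁ v₂ v₃ : ℝ}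
    (ha : -1 < a) (hb : -1 < b) (hc : -1 < c)
    (γ₁ : 0 ≤ a + b * c) (γ₂ : 0 ≤ b + a * c) (γ₃ : 0 ≤ c + a * b)
    (hx : 0 < x) (hy : 0 < y) (hz : 0 < z) {A : ℝ → ℝ → ℝ → ℝ}
    (hA : ∀ s₁ s₂ s₃, A s₁ s₂ s₃ = Real.arccos ((s₂ + s₃ - s₁) / 2 / √(s₂ * s₃)))
    {s₁ s₂ s₃ s₁' s₂' s₃' : ℝ}
    (hs₁ : s₁ = y ^ 2 + z ^ 2 + 2 * y * z * a) (hs₂ : s₂ = x ^ 2 + z ^ 2 + 2 * x * z * b)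
    (hs₃ : s₃ = x ^ 2 + y ^ 2 + 2 * x * y * c)
    (hs₁' : s₁' = (y * Real.exp v₂) ^ 2 + (z * Real.exp v₃) ^ 2
      + 2 * (y * Real.exp v₂) * (z * Real.exp v₃) * a)
    (hs₂' : s₂' = (x * Real.exp v₁) ^ 2 + (z * Real.exp v₃) ^ 2
      + 2 * (x * Real.exp v₁) * (z * Real.exp v₃) * b)
    (hs₃' : s₃' = (x * Real.exp v₁) ^ 2 + (y * Real.exp v₂) ^ 2
      + 2 * (x * Real.exp v₁) * (y * Real.exp v₂) * c)
    (hW : 0 < s₂ * s₃ - ((s₂ + s₃ - s₁) / 2) ^ 2) (hv : ¬ (v₁ = v₂ ∧ v₁ = v₃)) :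
    v₁ * A s₁' s₂' s₃' + v₂ * A s₂' s₁' s₃' + v₃ * A s₃' s₁' s₂'
      < v₁ * A s₁ s₂ s₃ + v₂ * A s₂ s₁ s₃ + v₃ * A s₃ s₁ s₂ := by
  -- The logarithms of the radii move affinely, with velocities `vᵢ`.
  set X : ℝ → ℝ := fun t => x * Real.exp (t * v₁) with hX
  set Y : ℝ → ℝ := fun t => y * Real.exp (t * v₂) with hY
  set Z : ℝ → ℝ := fun t => z * Real.exp (t * v₃) with hZ
  have dexp : ∀ x v t : ℝ, HasDerivAt (fun t => x * Real.exp (t * v)) (v * (x * Real.exp (t * v))) t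
      := by
    intro x v t
    refine ((((hasDerivAt_id t).mul_const v).exp).const_mul x).congr_deriv ?_
    simp only [id]
    ring
  set σ₁ : ℝ → ℝ := fun t => Y t ^ 2 + Z t ^ 2 + 2 * Y t * Z t * a with hσ₁
  set σ₂ : ℝ → ℝ := fun t => X t ^ 2 + Z t ^ 2 + 2 * X t * Z t * b with hσ₂
  set σ₃ : ℝ → ℝ := fun t => X t ^ 2 + Y t ^ 2 + 2 * X t * Y t * c with hσ₃
  have pX : ∀ t, 0 < X t := fun t => mul_pos hx (Real.exp_pos _)
  have pY : ∀ t, 0 < Y t := fun t => mul_pos hy (Real.exp_pos _)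
  have pZ : ∀ t, 0 < Z t := fun t => mul_pos hz (Real.exp_pos _)
  have p₁ : ∀ t, 0 < σ₁ t := fun t => sq_length_pos (pY t) (pZ t) ha
  have p₂ : ∀ t, 0 < σ₂ t := fun t => sq_length_pos (pX t) (pZ t) hb
  have p₃ : ∀ t, 0 < σ₃ t := fun t => sq_length_pos (pX t) (pY t) hc
  have d₁ := fun t => HasDerivAt.sq_length a (dexp y v₂ t) (dexp z v₃ t)
  have d₂ := fun t => HasDerivAt.sq_length b (dexp x v₁ t) (dexp z v₃ t)
  have d₃ := fun t => HasDerivAt.sq_length c (dexp x v₁ t) (dexp y v₂ t)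
  have key := weighted_angle_sum_lt (v₁ := v₁) (v₂ := v₂) (v₃ := v₃)
    (N₁ := fun t => (σ₂ t + σ₃ t - σ₁ t) / 2)
    (N₂ := fun t => (σ₁ t + σ₃ t - σ₂ t) / 2) (N₃ := fun t => (σ₁ t + σ₂ t - σ₃ t) / 2)
    (p₁ := σ₁) (p₂ := σ₂) (p₃ := σ₃) (W := fun t => σ₂ t * σ₃ t - ((σ₂ t + σ₃ t - σ₁ t) / 2) ^ 2)
    (fun t _ => ⟨p₁ t, p₂ t, p₃ t⟩)
    (fun t _ => ⟨_, _, _, _, _, _, (((d₂ t).add (d₃ t)).sub (d₁ t)).div_const 2,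
      (((d₁ t).add (d₃ t)).sub (d₂ t)).div_const 2, (((d₁ t).add (d₂ t)).sub (d₃ t)).div_const 2,
      d₁ t, d₂ t, d₃ t, fun hWt => by
        have := euclidean_form_pos ha hb hc γ₁ γ₂ γ₃ (pX t) (pY t) (pZ t) rfl rfl rfl
          (p₁ t) (p₂ t) (p₃ t) hWt hv
        rw [← euclidean_variation_eq (v₁ := v₁) rfl rfl rfl (p₁ t).ne' (p₂ t).ne' (p₃ t).ne'
          rfl rfl rfl] at this
        exact this⟩)
    (fun t => rfl) (fun t => by ring) (fun t => by ring)
    (by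
      simp only [hσ₁, hσ₂, hσ₃, hX, hY, hZ, zero_mul, Real.exp_zero, mul_one]
      rw [← hs₁, ← hs₂, ← hs₃]; exact hW)
  simp only [hσ₁, hσ₂, hσ₃, hX, hY, hZ, zero_mul, Real.exp_zero, mul_one, one_mul] at key
  rw [← hs₁, ← hs₂, ← hs₃, ← hs₁', ← hs₂', ← hs₃'] at key
  simp only [hA]
  exact key

/-! ### Hyperbolic conformal coordinate and triangle monotonicity -/

/-- Minus the logarithm of `tanh (r / 2)`. -/
noncomputable def hyperbolicConformalFactor (r : ℝ) : ℝ := Real.arsinh (1 / Real.sinh r)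

theorem hyperbolicConformalFactor_pos {r : ℝ} (hr : 0 < r) : 0 < hyperbolicConformalFactor r :=
  Real.arsinh_pos_iff.mpr (one_div_pos.mpr (Real.sinh_pos_iff.mpr hr))

theorem hyperbolicConformalFactor_injective : Function.Injective hyperbolicConformalFactor := by
  intro r r' h
  have := Real.arsinh_injective h
  rw [one_div, one_div] at this
  exact Real.sinh_injective (inv_injective this)

theorem sinh_hyperbolicConformalFactor (r : ℝ) :
    1 / Real.sinh (hyperbolicConformalFactor r) = Real.sinh r := by
  rw [hyperbolicConformalFactor, Real.sinh_arsinh, one_div_one_div]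

theorem cosh_hyperbolicConformalFactor {r : ℝ} (hr : 0 < r) :
    Real.cosh (hyperbolicConformalFactor r) / Real.sinh (hyperbolicConformalFactor r)
      = Real.cosh r := by
  have hs := Real.sinh_pos_iff.mpr hr
  have e : 1 + (1 / Real.sinh r) ^ 2 = (Real.cosh r / Real.sinh r) ^ 2 := by
    rw [div_pow, div_pow, Real.cosh_sq]; field_simp
  rw [hyperbolicConformalFactor, Real.sinh_arsinh, Real.cosh_arsinh, e,
    Real.sqrt_sq (div_nonneg (Real.cosh_pos r).le hs.le)]
  field_simp

/-- The path of radii from `r` to `r'` on which the conformal factor is affine. -/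
theorem exists_hyperbolic_path {r r' : ℝ} (hr : 0 < r) (hr' : 0 < r') {v : ℝ}
    (hv : v = hyperbolicConformalFactor r - hyperbolicConformalFactor r') :
    ∃ C S : ℝ → ℝ, C 0 = Real.cosh r ∧ S 0 = Real.sinh r ∧ C 1 = Real.cosh r' ∧
      S 1 = Real.sinh r' ∧ ∀ t ∈ Set.Icc (0 : ℝ) 1, C t ^ 2 = S t ^ 2 + 1 ∧ 0 < C t ∧ 0 < S t ∧
        HasDerivAt C (v * S t ^ 2) t ∧ HasDerivAt S (v * (S t * C t)) t := by
  set L : ℝ → ℝ := fun t => hyperbolicConformalFactor r - t * v with hL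
  have hL0 : L 0 = hyperbolicConformalFactor r := by simp [hL]
  have hL1 : L 1 = hyperbolicConformalFactor r' := by simp [hL, hv]
  -- The relation `sinh r * sinh L = 1` turns `cosh r` into `coth L` and `sinh r` into `1 / sinh L`.
  -- With `L' = -v` this gives the required derivatives without differentiating `r` itself.
  refine ⟨fun t => Real.cosh (L t) / Real.sinh (L t), fun t => 1 / Real.sinh (L t), ?_, ?_, ?_, ?_,
    fun t ht => ?_⟩
  · simp only [hL0]; exact cosh_hyperbolicConformalFactor hr
  · simp only [hL0]; exact sinh_hyperbolicConformalFactor r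
  · simp only [hL1]; exact cosh_hyperbolicConformalFactor hr'
  · simp only [hL1]; exact sinh_hyperbolicConformalFactor r'
  have hLt : 0 < L t := by
    have h0 := hyperbolicConformalFactor_pos hr
    have h1 := hyperbolicConformalFactor_pos hr'
    have e : L t = (1 - t) * hyperbolicConformalFactor r + t * hyperbolicConformalFactor r' := by
      simp only [hL, hv]; ring
    rw [e]
    rcases ht.1.eq_or_lt with h | h
    · rw [← h]; linarith
    · exact add_pos_of_nonneg_of_pos (mul_nonneg (by linarith [ht.2]) h0.le) (mul_pos h h1)
  have hs : 0 < Real.sinh (L t) := Real.sinh_pos_iff.mpr hLt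
  have hc : 0 < Real.cosh (L t) := Real.cosh_pos _
  have hd : HasDerivAt L (-v) t := by
    refine (((hasDerivAt_id t).mul_const v).const_sub _).congr_deriv ?_
    simp
  refine ⟨?_, div_pos hc hs, one_div_pos.mpr hs, ?_, ?_⟩
  · simp only [div_pow]; rw [Real.cosh_sq]; field_simp; ring
  · refine (hd.cosh.div hd.sinh hs.ne').congr_deriv ?_
    field_simp
    rw [Real.cosh_sq]; ring
  · refine ((hasDerivAt_const t (1 : ℝ)).div hd.sinh hs.ne').congr_deriv ?_
    field_simp
    ring

/-- The Pythagorean relations absorb `I` into the side cosine, giving the derivative in the form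
that `hyperbolic_variation_eq` needs. -/
theorem HasDerivAt.cosh_length {C D S T : ℝ → ℝ} {v w t : ℝ} (I : ℝ)
    (hC : HasDerivAt C (v * S t ^ 2) t) (hS : HasDerivAt S (v * (S t * C t)) t)
    (hD : HasDerivAt D (w * T t ^ 2) t) (hT : HasDerivAt T (w * (T t * D t)) t)
    (e₁ : C t ^ 2 = S t ^ 2 + 1) (e₂ : D t ^ 2 = T t ^ 2 + 1) :
    HasDerivAt (fun τ => C τ * D τ + I * (S τ * T τ))
      (v * (C t * (C t * D t + I * (S t * T t)) - D t)
        + w * (D t * (C t * D t + I * (S t * T t)) - C t)) t := by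
  refine ((hC.mul hD).add ((hS.mul hT).const_mul I)).congr_deriv ?_
  linear_combination (-v * D t) * e₁ - w * C t * e₂

theorem IsCircleTriple.variation_pos {C₁ S₁ C₂ S₂ C₃ S₃ a b c : ℝ}
    (h : IsCircleTriple C₁ S₁ C₂ S₂ C₃ S₃ a b c) {c₁ c₂ c₃ : ℝ}
    (e₁ : c₁ = C₂ * C₃ + a * (S₂ * S₃)) (e₂ : c₂ = C₁ * C₃ + b * (S₁ * S₃))
    (e₃ : c₃ = C₁ * C₂ + c * (S₁ * S₂)) (hW : 0 < hyperbolicGram c₁ c₂ c₃) {v₁ v₂ v₃ : ℝ}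
    (hv : ¬ (v₁ = 0 ∧ v₂ = 0 ∧ v₃ = 0)) {c₁' c₂' c₃' : ℝ}
    (h₁ : c₁' = v₂ * (C₂ * c₁ - C₃) + v₃ * (C₃ * c₁ - C₂))
    (h₂ : c₂' = v₁ * (C₁ * c₂ - C₃) + v₃ * (C₃ * c₂ - C₁))
    (h₃ : c₃' = v₁ * (C₁ * c₃ - C₂) + v₂ * (C₂ * c₃ - C₁)) :
    0 < v₁ * ((c₂' * c₃ + c₂ * c₃' - c₁') - (c₂ * c₃ - c₁) *
          (2 * c₂ * c₂' / (2 * (c₂ ^ 2 - 1)) + 2 * c₃ * c₃' / (2 * (c₃ ^ 2 - 1))))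
      + v₂ * ((c₁' * c₃ + c₁ * c₃' - c₂') - (c₁ * c₃ - c₂) *
          (2 * c₁ * c₁' / (2 * (c₁ ^ 2 - 1)) + 2 * c₃ * c₃' / (2 * (c₃ ^ 2 - 1))))
      + v₃ * ((c₁' * c₂ + c₁ * c₂' - c₃') - (c₁ * c₂ - c₃) *
          (2 * c₁ * c₁' / (2 * (c₁ ^ 2 - 1)) + 2 * c₂ * c₂' / (2 * (c₂ ^ 2 - 1)))) := by
  have p₁ : 0 < c₁ ^ 2 - 1 := by rw [e₁]; exact h.sq_c₁_sub_one_pos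
  have p₂ : 0 < c₂ ^ 2 - 1 := by rw [e₂]; exact h.sq_c₂_sub_one_pos
  have p₃ : 0 < c₃ ^ 2 - 1 := by rw [e₃]; exact h.sq_c₃_sub_one_pos
  rw [hyperbolic_variation_eq p₁.ne' p₂.ne' p₃.ne' h₁ h₂ h₃]
  refine (h.form_pos e₁ e₂ e₃ hW hv).trans_eq ?_
  have f₁ := hyperbolic_weight_eq (a := a) (b := b) (c := c) (C₁ := C₁) (S₁ := S₁) h.sq₂ h.sq₃
  have f₂ := hyperbolic_weight_eq (a := b) (b := a) (c := c) (C₁ := C₂) (S₁ := S₂) h.sq₁ h.sq₃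
  have f₃ := hyperbolic_weight_eq (a := c) (b := a) (c := b) (C₁ := C₃) (S₁ := S₃) h.sq₁ h.sq₂
  congr 1
  · rw [hyperbolicWeight, hyperbolicHeight, ← f₁, e₁, e₂, e₃]
  · rw [hyperbolicWeight, hyperbolicHeight, ← f₂, e₁, e₂, e₃]
    congr 1; ring
  · rw [hyperbolicWeight, hyperbolicHeight, ← f₃, e₁, e₂, e₃]
    congr 1; ring

/-- Strict monotonicity of the angles of a hyperbolic triangle of circles with fixed inversive
distances, as functions of the conformal factors; the second triangle may degenerate. -/
theorem hyperbolic_triangle_monotone {a b c x y z x' y' z' v₁ v₂ v₃ : ℝ}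
    (ha : -1 < a) (hb : -1 < b) (hc : -1 < c)
    (γ₁ : 0 ≤ a + b * c) (γ₂ : 0 ≤ b + a * c) (γ₃ : 0 ≤ c + a * b)
    (hx : 0 < x) (hy : 0 < y) (hz : 0 < z) (hx' : 0 < x') (hy' : 0 < y') (hz' : 0 < z')
    {A : ℝ → ℝ → ℝ → ℝ}
    (hA : ∀ c₁ c₂ c₃, A c₁ c₂ c₃
      = Real.arccos ((c₂ * c₃ - c₁) / √((c₂ ^ 2 - 1) * (c₃ ^ 2 - 1))))
    {c₁ c₂ c₃ c₁' c₂' c₃' : ℝ}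
    (hc₁ : c₁ = Real.cosh y * Real.cosh z + a * (Real.sinh y * Real.sinh z))
    (hc₂ : c₂ = Real.cosh x * Real.cosh z + b * (Real.sinh x * Real.sinh z))
    (hc₃ : c₃ = Real.cosh x * Real.cosh y + c * (Real.sinh x * Real.sinh y))
    (hc₁' : c₁' = Real.cosh y' * Real.cosh z' + a * (Real.sinh y' * Real.sinh z'))
    (hc₂' : c₂' = Real.cosh x' * Real.cosh z' + b * (Real.sinh x' * Real.sinh z'))
    (hc₃' : c₃' = Real.cosh x' * Real.cosh y' + c * (Real.sinh x' * Real.sinh y'))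
    (hv₁ : v₁ = hyperbolicConformalFactor x - hyperbolicConformalFactor x')
    (hv₂ : v₂ = hyperbolicConformalFactor y - hyperbolicConformalFactor y')
    (hv₃ : v₃ = hyperbolicConformalFactor z - hyperbolicConformalFactor z')
    (hW : 0 < hyperbolicGram c₁ c₂ c₃) (hv : ¬ (v₁ = 0 ∧ v₂ = 0 ∧ v₃ = 0)) :
    v₁ * A c₁' c₂' c₃' + v₂ * A c₂' c₁' c₃' + v₃ * A c₃' c₁' c₂'
      < v₁ * A c₁ c₂ c₃ + v₂ * A c₂ c₁ c₃ + v₃ * A c₃ c₁ c₂ := by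
  obtain ⟨C₁, S₁, C₁0, S₁0, C₁1, S₁1, P₁⟩ := exists_hyperbolic_path hx hx' hv₁
  obtain ⟨C₂, S₂, C₂0, S₂0, C₂1, S₂1, P₂⟩ := exists_hyperbolic_path hy hy' hv₂
  obtain ⟨C₃, S₃, C₃0, S₃0, C₃1, S₃1, P₃⟩ := exists_hyperbolic_path hz hz' hv₃
  have tri : ∀ t ∈ Set.Icc (0 : ℝ) 1,
      IsCircleTriple (C₁ t) (S₁ t) (C₂ t) (S₂ t) (C₃ t) (S₃ t) a b c := by
    intro t ht
    obtain ⟨q₁, C₁p, S₁p, _⟩ := P₁ t ht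
    obtain ⟨q₂, C₂p, S₂p, _⟩ := P₂ t ht
    obtain ⟨q₃, C₃p, S₃p, _⟩ := P₃ t ht
    exact ⟨q₁, q₂, q₃, C₁p, C₂p, C₃p, S₁p, S₂p, S₃p, ha, hb, hc, γ₁, γ₂, γ₃⟩
  set σ₁ : ℝ → ℝ := fun t => C₂ t * C₃ t + a * (S₂ t * S₃ t) with hσ₁
  set σ₂ : ℝ → ℝ := fun t => C₁ t * C₃ t + b * (S₁ t * S₃ t) with hσ₂
  set σ₃ : ℝ → ℝ := fun t => C₁ t * C₂ t + c * (S₁ t * S₂ t) with hσ₃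
  have p₁ : ∀ t ∈ Set.Icc (0 : ℝ) 1, 0 < σ₁ t ^ 2 - 1 := fun t ht =>
    (tri t ht).sq_c₁_sub_one_pos
  have p₂ : ∀ t ∈ Set.Icc (0 : ℝ) 1, 0 < σ₂ t ^ 2 - 1 := fun t ht =>
    (tri t ht).sq_c₂_sub_one_pos
  have p₃ : ∀ t ∈ Set.Icc (0 : ℝ) 1, 0 < σ₃ t ^ 2 - 1 := fun t ht =>
    (tri t ht).sq_c₃_sub_one_pos
  have dsq : ∀ {f : ℝ → ℝ} {f' t : ℝ}, HasDerivAt f f' t →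
      HasDerivAt (fun τ => f τ ^ 2 - 1) (2 * f t * f') t := by
    intro f f' t h
    refine ((h.pow 2).sub_const 1).congr_deriv ?_
    simp
  have key := weighted_angle_sum_lt (v₁ := v₁) (v₂ := v₂) (v₃ := v₃)
    (N₁ := fun t => σ₂ t * σ₃ t - σ₁ t)
    (N₂ := fun t => σ₁ t * σ₃ t - σ₂ t) (N₃ := fun t => σ₁ t * σ₂ t - σ₃ t)
    (p₁ := fun t => σ₁ t ^ 2 - 1) (p₂ := fun t => σ₂ t ^ 2 - 1) (p₃ := fun t => σ₃ t ^ 2 - 1)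
    (W := fun t => hyperbolicGram (σ₁ t) (σ₂ t) (σ₃ t))
    (fun t ht => ⟨p₁ t ht, p₂ t ht, p₃ t ht⟩)
    (fun t ht => by
      obtain ⟨q₁, -, -, dC₁, dS₁⟩ := P₁ t ht
      obtain ⟨q₂, -, -, dC₂, dS₂⟩ := P₂ t ht
      obtain ⟨q₃, -, -, dC₃, dS₃⟩ := P₃ t ht
      have d₁ := HasDerivAt.cosh_length a dC₂ dS₂ dC₃ dS₃ q₂ q₃
      have d₂ := HasDerivAt.cosh_length b dC₁ dS₁ dC₃ dS₃ q₁ q₃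
      have d₃ := HasDerivAt.cosh_length c dC₁ dS₁ dC₂ dS₂ q₁ q₂
      refine ⟨_, _, _, _, _, _, (d₂.mul d₃).sub d₁, (d₁.mul d₃).sub d₂, (d₁.mul d₂).sub d₃,
        dsq d₁, dsq d₂, dsq d₃, fun hWt => ?_⟩
      exact (tri t ht).variation_pos rfl rfl rfl hWt hv rfl rfl rfl)
    (fun t => by simp only [hyperbolicGram]; ring) (fun t => by simp only [hyperbolicGram]; ring)
    (fun t => by simp only [hyperbolicGram]; ring)
    (by
      simp only [hσ₁, hσ₂, hσ₃, C₁0, C₂0, C₃0, S₁0, S₂0, S₃0]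
      rw [← hc₁, ← hc₂, ← hc₃]; exact hW)
  simp only [hσ₁, hσ₂, hσ₃, C₁0, C₂0, C₃0, S₁0, S₂0, S₃0, C₁1, C₂1, C₃1, S₁1, S₂1, S₃1] at key
  rw [← hc₁, ← hc₂, ← hc₃, ← hc₁', ← hc₂', ← hc₃'] at key
  simp only [hA]
  exact key

/-! ### Combinatorics of faces and summation over the surface -/

theorem rotate_face {V : Type*} [DecidableEq V] {i j k : V} : ({j, k, i} : Finset V) = {i, j, k} := by
  ext x; simp only [Finset.mem_insert, Finset.mem_singleton]; tauto

theorem swap_face {V : Type*} [DecidableEq V] {i j k : V} : ({j, i, k} : Finset V) = {i, j, k} := Finset.insert_comm _ _ _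

namespace ClosedTriangulatedSurface

variable {V : Type*} [Fintype V] [DecidableEq V]

theorem ne_of_mem_faces (T : ClosedTriangulatedSurface V) {i j k : V}
    (h : ({i, j, k} : Finset V) ∈ T.faces) : i ≠ j := by
  rintro rfl
  have h3 := T.card_eq_three _ h
  rw [Finset.insert_eq_of_mem (Finset.mem_insert_self _ _)] at h3
  have := Finset.card_le_two (a := i) (b := k)
  omega

theorem adj_of_mem_faces (T : ClosedTriangulatedSurface V) {i j k : V}
    (h : ({i, j, k} : Finset V) ∈ T.faces) : T.graph.Adj i j :=
  ⟨T.ne_of_mem_faces h, _, h, by simp, by simp⟩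

theorem exists_face_of_adj (T : ClosedTriangulatedSurface V) {i j : V} (h : T.graph.Adj i j) :
    ∃ k, ({i, j, k} : Finset V) ∈ T.faces := by
  obtain ⟨hne, f, hf, hi, hj⟩ := h
  have hj' : j ∈ f.erase i := Finset.mem_erase.mpr ⟨hne.symm, hj⟩
  have hc : ((f.erase i).erase j).card = 1 := by
    rw [Finset.card_erase_of_mem hj', Finset.card_erase_of_mem hi, T.card_eq_three f hf]
  obtain ⟨k, hk⟩ := Finset.card_eq_one.mp hc
  refine ⟨k, ?_⟩
  rwa [← hk, Finset.insert_erase hj', Finset.insert_erase hi]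

theorem exists_adj (T : ClosedTriangulatedSurface V) (i : V) : ∃ j, T.graph.Adj i j := by
  obtain ⟨n, hn, ⟨e⟩⟩ := T.link_cycle i
  exact ⟨(e.symm ⟨0, by omega⟩).1, (e.symm ⟨0, by omega⟩).2⟩

/-- Inversive distances exceed `-1` on the edges of a face. -/
theorem neg_one_lt_of_mem_faces (T : ClosedTriangulatedSurface V) {I : Sym2 V → ℝ}
    (hI : ∀ i j : V, T.graph.Adj i j → -1 < I s(i, j)) {i j k : V}
    (h : ({i, j, k} : Finset V) ∈ T.faces) :
    -1 < I s(j, k) ∧ -1 < I s(i, k) ∧ -1 < I s(i, j) := by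
  refine ⟨hI _ _ (T.adj_of_mem_faces (k := i) (by rwa [rotate_face])), ?_,
    hI _ _ (T.adj_of_mem_faces h)⟩
  refine hI _ _ (T.adj_of_mem_faces (k := j) ?_)
  rwa [Finset.pair_comm k j]

theorem TriangleInequalities.sides {T : ClosedTriangulatedSurface V} {l : V → V → ℝ}
    (hT : T.TriangleInequalities l) (hl : ∀ i j, l i j = l j i) {i j k : V}
    (h : ({i, j, k} : Finset V) ∈ T.faces) :
    l j k < l i k + l i j ∧ l i k < l j k + l i j ∧ l i j < l j k + l i k := by
  have h1 := hT i j k h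
  have h2 := hT j i k (by rwa [swap_face])
  have h3 := hT k i j (by rwa [← rotate_face])
  rw [hl j i] at h2
  rw [hl k i, hl k j] at h3
  exact ⟨by linarith, by linarith, by linarith⟩

/-- If on each face the weighted sum of the angles decreases, strictly unless the face satisfies
`D`, then equality of all angle sums forces `D` on all faces. -/
theorem forall_faces_of_angleSum_eq (T : ClosedTriangulatedSurface V) {angle : ℝ → ℝ → ℝ → ℝ}
    {l l' : V → V → ℝ} (v : V → ℝ) (D : V → V → V → Prop)
    (hK : ∀ i, T.angleSum angle l i = T.angleSum angle l' i)
    (hD : ∀ i j k, ({i, j, k} : Finset V) ∈ T.faces → D i j k →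
      v i * angle (l' j k) (l' i j) (l' i k) + v j * angle (l' k i) (l' j k) (l' j i)
          + v k * angle (l' i j) (l' k i) (l' k j)
        = v i * angle (l j k) (l i j) (l i k) + v j * angle (l k i) (l j k) (l j i)
          + v k * angle (l i j) (l k i) (l k j))
    (hlt : ∀ i j k, ({i, j, k} : Finset V) ∈ T.faces → ¬ D i j k →
      v i * angle (l' j k) (l' i j) (l' i k) + v j * angle (l' k i) (l' j k) (l' j i)
          + v k * angle (l' i j) (l' k i) (l' k j)
        < v i * angle (l j k) (l i j) (l i k) + v j * angle (l k i) (l j k) (l j i)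
          + v k * angle (l i j) (l k i) (l k j)) :
    ∀ i j k, ({i, j, k} : Finset V) ∈ T.faces → D i j k := by
  -- `E` is the cyclic symmetrisation of the one-vertex term `G`. Rotating the indices shows that
  -- its sum over ordered triples is three times that of `G`, so equal angle sums give equal totals
  -- of `E`, which can be compared face by face.
  set E : (V → V → ℝ) → V → V → V → ℝ := fun l i j k =>
    if ({i, j, k} : Finset V) ∈ T.faces then v i * angle (l j k) (l i j) (l i k)
      + v j * angle (l k i) (l j k) (l j i) + v k * angle (l i j) (l k i) (l k j) else 0 with hE
  set G : (V → V → ℝ) → V → V → V → ℝ := fun l i j k =>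
    if ({i, j, k} : Finset V) ∈ T.faces then v i * angle (l j k) (l i j) (l i k) else 0 with hG
  have hsum : ∀ l, ∑ i, v i * T.angleSum angle l i = (∑ i, ∑ j, ∑ k, G l i j k) / 2 := by
    intro l
    rw [Finset.sum_div]
    refine Finset.sum_congr rfl fun i _ => ?_
    rw [angleSum, mul_div_assoc', Finset.mul_sum]
    congr 1
    refine Finset.sum_congr rfl fun j _ => ?_
    rw [Finset.mul_sum]
    refine Finset.sum_congr rfl fun k _ => ?_
    simp only [hG, mul_ite, mul_zero]
  have hrot : ∀ g : V → V → V → ℝ, ∑ i, ∑ j, ∑ k, g j k i = ∑ i, ∑ j, ∑ k, g i j k := by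
    intro g
    rw [Finset.sum_comm]
    refine Finset.sum_congr rfl fun i _ => ?_
    rw [Finset.sum_comm]
  have hEG : ∀ l i j k, E l i j k = G l i j k + G l j k i + G l k i j := by
    intro l i j k
    have e1 : ({j, k, i} : Finset V) = {i, j, k} := rotate_face
    have e2 : ({k, i, j} : Finset V) = {i, j, k} := rotate_face.symm
    simp only [hE, hG, e1, e2]
    split_ifs <;> simp
  have hthree : ∀ l, ∑ i, ∑ j, ∑ k, E l i j k = 3 * ∑ i, ∑ j, ∑ k, G l i j k := by
    intro l
    simp only [hEG, Finset.sum_add_distrib]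
    rw [hrot (G l), ← hrot fun i j k => G l k i j]
    ring
  have heq : ∑ i, ∑ j, ∑ k, E l' i j k = ∑ i, ∑ j, ∑ k, E l i j k := by
    have h1 := hsum l
    have h2 := hsum l'
    simp only [hK] at h1
    rw [hthree, hthree]
    linarith
  have hle : ∀ i j k, E l' i j k ≤ E l i j k := by
    intro i j k
    simp only [hE]
    split_ifs with hf
    · by_cases hd : D i j k
      · exact (hD i j k hf hd).le
      · exact (hlt i j k hf hd).le
    · exact le_rfl
  intro i j k hf
  by_contra hd
  have hstrict : E l' i j k < E l i j k := by
    simp only [hE, if_pos hf]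
    exact hlt i j k hf hd
  refine heq.not_lt ?_
  refine Finset.sum_lt_sum (fun i _ => Finset.sum_le_sum fun j _ => Finset.sum_le_sum fun k _ =>
    hle i j k) ⟨i, Finset.mem_univ _, ?_⟩
  refine Finset.sum_lt_sum (fun j _ => Finset.sum_le_sum fun k _ => hle i j k)
    ⟨j, Finset.mem_univ _, ?_⟩
  exact Finset.sum_lt_sum (fun k _ => hle i j k) ⟨k, Finset.mem_univ _, hstrict⟩

end ClosedTriangulatedSurface

/-! ### Angles and triangle inequalities in terms of squares and hyperbolic cosines of sides -/

theorem euclideanLength_comm {V : Type*} (I : Sym2 V → ℝ) (r : V → ℝ) (i j : V) :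
    euclideanLength I r i j = euclideanLength I r j i := by
  rw [euclideanLength, euclideanLength, Sym2.eq_swap]
  congr 1; ring

theorem hyperbolicLength_comm {V : Type*} (I : Sym2 V → ℝ) (r : V → ℝ) (i j : V) :
    hyperbolicLength I r i j = hyperbolicLength I r j i := by
  rw [hyperbolicLength, hyperbolicLength, Sym2.eq_swap]
  congr 1; ring

/-- The Euclidean angle in terms of squared side lengths. -/
noncomputable def sqEuclideanAngle (s₁ s₂ s₃ : ℝ) : ℝ :=
  Real.arccos ((s₂ + s₃ - s₁) / 2 / √(s₂ * s₃))

/-- The hyperbolic angle in terms of the hyperbolic cosines of the sides. -/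
noncomputable def coshHyperbolicAngle (c₁ c₂ c₃ : ℝ) : ℝ :=
  Real.arccos ((c₂ * c₃ - c₁) / √((c₂ ^ 2 - 1) * (c₃ ^ 2 - 1)))

theorem sqEuclideanAngle_comm (s₁ s₂ s₃ : ℝ) :
    sqEuclideanAngle s₁ s₂ s₃ = sqEuclideanAngle s₁ s₃ s₂ := by
  rw [sqEuclideanAngle, sqEuclideanAngle, add_comm s₂, mul_comm s₂]

theorem coshHyperbolicAngle_comm (c₁ c₂ c₃ : ℝ) :
    coshHyperbolicAngle c₁ c₂ c₃ = coshHyperbolicAngle c₁ c₃ c₂ := by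
  rw [coshHyperbolicAngle, coshHyperbolicAngle, mul_comm c₂, mul_comm (c₂ ^ 2 - 1)]

theorem sqEuclideanAngle_mul {m : ℝ} (hm : 0 < m) (s₁ s₂ s₃ : ℝ) :
    sqEuclideanAngle (m * s₁) (m * s₂) (m * s₃) = sqEuclideanAngle s₁ s₂ s₃ := by
  rw [sqEuclideanAngle, sqEuclideanAngle, show m * s₂ * (m * s₃) = m ^ 2 * (s₂ * s₃) by ring,
    Real.sqrt_mul (sq_nonneg m), Real.sqrt_sq hm.le,
    show (m * s₂ + m * s₃ - m * s₁) / 2 = m * ((s₂ + s₃ - s₁) / 2) by ring,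
    mul_div_mul_left _ _ hm.ne']

theorem euclideanAngle_sqrt {s₁ s₂ s₃ : ℝ} (h₁ : 0 < s₁) (h₂ : 0 < s₂) (h₃ : 0 < s₃) :
    euclideanAngle (√s₁) (√s₂) (√s₃) = sqEuclideanAngle s₁ s₂ s₃ := by
  rw [euclideanAngle, sqEuclideanAngle, Real.sq_sqrt h₁.le, Real.sq_sqrt h₂.le,
    Real.sq_sqrt h₃.le, Real.sqrt_mul h₂.le, mul_assoc, div_div]

theorem hyperbolicAngle_arcosh {c₁ c₂ c₃ : ℝ} (h₁ : 1 < c₁) (h₂ : 1 < c₂) (h₃ : 1 < c₃) :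
    hyperbolicAngle (Real.arcosh c₁) (Real.arcosh c₂) (Real.arcosh c₃)
      = coshHyperbolicAngle c₁ c₂ c₃ := by
  have : 0 ≤ c₂ ^ 2 - 1 := sub_nonneg.mpr (one_le_pow₀ h₂.le)
  rw [hyperbolicAngle, coshHyperbolicAngle, Real.cosh_arcosh h₁.le, Real.cosh_arcosh h₂.le,
    Real.cosh_arcosh h₃.le, Real.sinh_arcosh h₂.le, Real.sinh_arcosh h₃.le, Real.sqrt_mul this]

/-- Heron's formula: the expression is four times the squared area, a product of the perimeter and
the three triangle excesses, divided by four. -/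
theorem euclidean_gram_pos {s₁ s₂ s₃ : ℝ} (p₁ : 0 < s₁) (p₂ : 0 < s₂) (p₃ : 0 < s₃)
    (h₁ : √s₁ < √s₂ + √s₃) (h₂ : √s₂ < √s₁ + √s₃) (h₃ : √s₃ < √s₁ + √s₂) :
    0 < s₂ * s₃ - ((s₂ + s₃ - s₁) / 2) ^ 2 := by
  have q₁ := Real.sqrt_pos.mpr p₁
  have e : s₂ * s₃ - ((s₂ + s₃ - s₁) / 2) ^ 2
      = (√s₁ + (√s₂ + √s₃)) * ((√s₂ + √s₃) - √s₁) * ((√s₁ + √s₃) - √s₂)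
        * ((√s₁ + √s₂) - √s₃) / 4 := by
    conv_lhs => rw [← Real.sq_sqrt p₁.le, ← Real.sq_sqrt p₂.le, ← Real.sq_sqrt p₃.le]
    ring
  rw [e]
  have := Real.sqrt_pos.mpr p₂
  have := Real.sqrt_pos.mpr p₃
  have := sub_pos.mpr h₁
  have := sub_pos.mpr h₂
  have := sub_pos.mpr h₃
  positivity

/-- With `lᵢ = arcosh cᵢ`, the Gram determinant is `(cosh (l₂ + l₃) - cosh l₁) * (cosh l₁ - cosh (l₂
- l₃))`, and the triangle inequalities make both factors positive. -/
theorem hyperbolic_gram_pos {c₁ c₂ c₃ : ℝ} (p₁ : 1 < c₁) (p₂ : 1 < c₂) (p₃ : 1 < c₃)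
    (h₁ : Real.arcosh c₁ < Real.arcosh c₂ + Real.arcosh c₃)
    (h₂ : Real.arcosh c₂ < Real.arcosh c₁ + Real.arcosh c₃)
    (h₃ : Real.arcosh c₃ < Real.arcosh c₁ + Real.arcosh c₂) :
    0 < hyperbolicGram c₁ c₂ c₃ := by
  have q₁ := Real.arcosh_pos p₁
  have k₁ : c₁ < Real.cosh (Real.arcosh c₂ + Real.arcosh c₃) := by
    rw [← Real.cosh_arcosh p₁.le, Real.cosh_lt_cosh, abs_of_pos q₁, abs_of_pos (q₁.trans h₁)]
    exact h₁
  have k₂ : Real.cosh (Real.arcosh c₂ - Real.arcosh c₃) < c₁ := by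
    conv_rhs => rw [← Real.cosh_arcosh p₁.le]
    rw [Real.cosh_lt_cosh, abs_of_pos q₁, abs_lt]
    constructor <;> linarith
  rw [Real.cosh_add, Real.cosh_arcosh p₂.le, Real.cosh_arcosh p₃.le] at k₁
  rw [Real.cosh_sub, Real.cosh_arcosh p₂.le, Real.cosh_arcosh p₃.le] at k₂
  have s₂ := Real.cosh_sq (Real.arcosh c₂)
  have s₃ := Real.cosh_sq (Real.arcosh c₃)
  rw [Real.cosh_arcosh p₂.le] at s₂
  rw [Real.cosh_arcosh p₃.le] at s₃
  set S := Real.sinh (Real.arcosh c₂)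
  set T := Real.sinh (Real.arcosh c₃)
  have := mul_pos (sub_pos.mpr k₁) (sub_pos.mpr k₂)
  have e : hyperbolicGram c₁ c₂ c₃ = (c₂ * c₃ + S * T - c₁) * (c₁ - (c₂ * c₃ - S * T)) := by
    unfold hyperbolicGram
    linear_combination (c₃ ^ 2 - 1) * s₂ + S ^ 2 * s₃
  rw [e]
  exact this

/-! ### Global rigidity -/

namespace ClosedTriangulatedSurface

variable {V : Type*} [Fintype V] [DecidableEq V]

theorem euclidean_rigidity (T : ClosedTriangulatedSurface V) (I : Sym2 V → ℝ)
    (hI : ∀ i j : V, T.graph.Adj i j → -1 < I s(i, j))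
    (hγ : ∀ i j k : V, ({i, j, k} : Finset V) ∈ T.faces →
      0 ≤ I s(i, j) + I s(i, k) * I s(j, k) ∧
      0 ≤ I s(i, k) + I s(i, j) * I s(j, k) ∧
      0 ≤ I s(j, k) + I s(i, j) * I s(i, k))
    {r r' : V → ℝ} (hr : T.IsEuclideanPacking I r) (hr' : T.IsEuclideanPacking I r')
    (hK : T.euclideanCurvature I r = T.euclideanCurvature I r') :
    ∃ c : ℝ, 0 < c ∧ ∀ i, r' i = c * r i := by
  set v : V → ℝ := fun i => Real.log (r' i / r i) with hv
  have hrv : ∀ i, r' i = r i * Real.exp (v i) := fun i => by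
    rw [hv, Real.exp_log (div_pos (hr'.1 i) (hr.1 i)), mul_div_cancel₀ _ (hr.1 i).ne']
  have hang : ∀ {r : V → ℝ} {i j k : V}, (∀ i, 0 < r i) → -1 < I s(j, k) → -1 < I s(i, k) →
      -1 < I s(i, j) → ∀ w : V → ℝ, w i * euclideanAngle (euclideanLength I r j k)
        (euclideanLength I r i j) (euclideanLength I r i k)
      + w j * euclideanAngle (euclideanLength I r k i)
        (euclideanLength I r j k) (euclideanLength I r j i)
      + w k * euclideanAngle (euclideanLength I r i j)
        (euclideanLength I r k i) (euclideanLength I r k j)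
      = w i * sqEuclideanAngle (r j ^ 2 + r k ^ 2 + 2 * r j * r k * I s(j, k))
        (r i ^ 2 + r k ^ 2 + 2 * r i * r k * I s(i, k))
        (r i ^ 2 + r j ^ 2 + 2 * r i * r j * I s(i, j))
      + w j * sqEuclideanAngle (r i ^ 2 + r k ^ 2 + 2 * r i * r k * I s(i, k))
        (r j ^ 2 + r k ^ 2 + 2 * r j * r k * I s(j, k))
        (r i ^ 2 + r j ^ 2 + 2 * r i * r j * I s(i, j))
      + w k * sqEuclideanAngle (r i ^ 2 + r j ^ 2 + 2 * r i * r j * I s(i, j))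
        (r j ^ 2 + r k ^ 2 + 2 * r j * r k * I s(j, k))
        (r i ^ 2 + r k ^ 2 + 2 * r i * r k * I s(i, k)) := by
    intro r i j k hr h₁ h₂ h₃ w
    have q₁ := sq_length_pos (hr j) (hr k) h₁
    have q₂ := sq_length_pos (hr i) (hr k) h₂
    have q₃ := sq_length_pos (hr i) (hr j) h₃
    rw [euclideanLength_comm I r k i, euclideanLength_comm I r j i, euclideanLength_comm I r k j]
    simp only [euclideanLength]
    rw [euclideanAngle_sqrt q₁ q₃ q₂, euclideanAngle_sqrt q₂ q₁ q₃, euclideanAngle_sqrt q₃ q₂ q₁,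
      sqEuclideanAngle_comm _ (r i ^ 2 + r j ^ 2 + 2 * r i * r j * I s(i, j)),
      sqEuclideanAngle_comm (r i ^ 2 + r j ^ 2 + 2 * r i * r j * I s(i, j))]
  have hfaces := T.forall_faces_of_angleSum_eq (angle := euclideanAngle)
    (l := euclideanLength I r) (l' := euclideanLength I r') v
    -- The exceptional case is a common scaling of the three radii, the kernel of the Euclidean
    -- form; the two triangles are then similar and have the same angles.
    (fun i j k => v i = v j ∧ v i = v k)
    (fun i => by
      have := congrFun hK i
      unfold euclideanCurvature at this
      linarith)
    (by
      rintro i j k hf ⟨hij, hik⟩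
      obtain ⟨h₁, h₂, h₃⟩ := T.neg_one_lt_of_mem_faces hI hf
      rw [hang hr'.1 h₁ h₂ h₃, hang hr.1 h₁ h₂ h₃, hrv i, hrv j, hrv k, ← hij, ← hik]
      set m := Real.exp (v i) with hm
      have hm0 : 0 < m ^ 2 := pow_pos (Real.exp_pos _) 2
      have e : ∀ x y a : ℝ, (x * m) ^ 2 + (y * m) ^ 2 + 2 * (x * m) * (y * m) * a
          = m ^ 2 * (x ^ 2 + y ^ 2 + 2 * x * y * a) := by intros; ring
      simp only [e, sqEuclideanAngle_mul hm0])
    (by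
      intro i j k hf hd
      obtain ⟨h₁, h₂, h₃⟩ := T.neg_one_lt_of_mem_faces hI hf
      obtain ⟨g₃, g₂, g₁⟩ := hγ i j k hf
      obtain ⟨t₁, t₂, t₃⟩ := hr.2.sides (euclideanLength_comm I r) hf
      rw [hang hr'.1 h₁ h₂ h₃, hang hr.1 h₁ h₂ h₃, hrv i, hrv j, hrv k]
      exact euclidean_triangle_monotone h₁ h₂ h₃ (by linarith) (by linarith) (by linarith)
        (hr.1 i) (hr.1 j) (hr.1 k) (A := sqEuclideanAngle) (fun _ _ _ => rfl)
        rfl rfl rfl rfl rfl rfl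
        (euclidean_gram_pos (sq_length_pos (hr.1 j) (hr.1 k) h₁)
          (sq_length_pos (hr.1 i) (hr.1 k) h₂) (sq_length_pos (hr.1 i) (hr.1 j) h₃) t₁ t₂ t₃) hd)
  have hadj : ∀ i j, T.graph.Adj i j → v i = v j := fun i j h => by
    obtain ⟨k, hk⟩ := T.exists_face_of_adj h
    exact (hfaces i j k hk).1
  -- Connectedness turns a separate scale on each face into one global constant.
  have hconst : ∀ i j, v i = v j := fun i j => by
    obtain ⟨p⟩ := T.connected.preconnected i j
    induction p with
    | nil => rfl
    | cons h _ ih => exact (hadj _ _ h).trans ih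
  obtain ⟨i₀⟩ := T.connected.nonempty
  exact ⟨Real.exp (v i₀), Real.exp_pos _, fun i => by rw [hrv i, hconst i i₀, mul_comm]⟩

theorem hyperbolic_rigidity (T : ClosedTriangulatedSurface V) (I : Sym2 V → ℝ)
    (hI : ∀ i j : V, T.graph.Adj i j → -1 < I s(i, j))
    (hγ : ∀ i j k : V, ({i, j, k} : Finset V) ∈ T.faces →
      0 ≤ I s(i, j) + I s(i, k) * I s(j, k) ∧
      0 ≤ I s(i, k) + I s(i, j) * I s(j, k) ∧
      0 ≤ I s(j, k) + I s(i, j) * I s(i, k))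
    {r r' : V → ℝ} (hr : T.IsHyperbolicPacking I r) (hr' : T.IsHyperbolicPacking I r')
    (hK : T.hyperbolicCurvature I r = T.hyperbolicCurvature I r') : r = r' := by
  set v : V → ℝ := fun i => hyperbolicConformalFactor (r i) - hyperbolicConformalFactor (r' i)
    with hv
  have hlen : ∀ {r : V → ℝ} {i j : V}, (∀ i, 0 < r i) → -1 < I s(i, j) →
      1 < Real.cosh (r i) * Real.cosh (r j) + I s(i, j) * (Real.sinh (r i) * Real.sinh (r j)) :=
    fun hr h => one_lt_cosh_length (Real.cosh_sq _) (Real.cosh_sq _) (Real.cosh_pos _)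
      (Real.cosh_pos _) (Real.sinh_pos_iff.mpr (hr _)) (Real.sinh_pos_iff.mpr (hr _)) h
  have hang : ∀ {r : V → ℝ} {i j k : V}, (∀ i, 0 < r i) → -1 < I s(j, k) → -1 < I s(i, k) →
      -1 < I s(i, j) → ∀ w : V → ℝ, w i * hyperbolicAngle (hyperbolicLength I r j k)
        (hyperbolicLength I r i j) (hyperbolicLength I r i k)
      + w j * hyperbolicAngle (hyperbolicLength I r k i)
        (hyperbolicLength I r j k) (hyperbolicLength I r j i)
      + w k * hyperbolicAngle (hyperbolicLength I r i j)
        (hyperbolicLength I r k i) (hyperbolicLength I r k j)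
      = w i * coshHyperbolicAngle
        (Real.cosh (r j) * Real.cosh (r k) + I s(j, k) * (Real.sinh (r j) * Real.sinh (r k)))
        (Real.cosh (r i) * Real.cosh (r k) + I s(i, k) * (Real.sinh (r i) * Real.sinh (r k)))
        (Real.cosh (r i) * Real.cosh (r j) + I s(i, j) * (Real.sinh (r i) * Real.sinh (r j)))
      + w j * coshHyperbolicAngle
        (Real.cosh (r i) * Real.cosh (r k) + I s(i, k) * (Real.sinh (r i) * Real.sinh (r k)))
        (Real.cosh (r j) * Real.cosh (r k) + I s(j, k) * (Real.sinh (r j) * Real.sinh (r k)))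
        (Real.cosh (r i) * Real.cosh (r j) + I s(i, j) * (Real.sinh (r i) * Real.sinh (r j)))
      + w k * coshHyperbolicAngle
        (Real.cosh (r i) * Real.cosh (r j) + I s(i, j) * (Real.sinh (r i) * Real.sinh (r j)))
        (Real.cosh (r j) * Real.cosh (r k) + I s(j, k) * (Real.sinh (r j) * Real.sinh (r k)))
        (Real.cosh (r i) * Real.cosh (r k) + I s(i, k) * (Real.sinh (r i) * Real.sinh (r k))) := by
    intro r i j k hr h₁ h₂ h₃ w
    have q₁ := hlen hr h₁
    have q₂ := hlen hr h₂
    have q₃ := hlen hr h₃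
    rw [hyperbolicLength_comm I r k i, hyperbolicLength_comm I r j i, hyperbolicLength_comm I r k j]
    simp only [hyperbolicLength]
    rw [hyperbolicAngle_arcosh q₁ q₃ q₂, hyperbolicAngle_arcosh q₂ q₁ q₃,
      hyperbolicAngle_arcosh q₃ q₂ q₁]
    congr 1
    · congr 1
      rw [coshHyperbolicAngle_comm]
    · rw [coshHyperbolicAngle_comm]
  have hfaces := T.forall_faces_of_angleSum_eq (angle := hyperbolicAngle)
    (l := hyperbolicLength I r) (l' := hyperbolicLength I r') v
    -- The hyperbolic form has no kernel, so a face is exceptional only if its radii do not change.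
    (fun i j k => v i = 0 ∧ v j = 0 ∧ v k = 0)
    (fun i => by
      have := congrFun hK i
      unfold hyperbolicCurvature at this
      linarith)
    (by
      rintro i j k hf ⟨hi, hj, hk⟩
      simp only [hi, hj, hk, zero_mul])
    (by
      intro i j k hf hd
      obtain ⟨h₁, h₂, h₃⟩ := T.neg_one_lt_of_mem_faces hI hf
      obtain ⟨g₃, g₂, g₁⟩ := hγ i j k hf
      obtain ⟨t₁, t₂, t₃⟩ := hr.2.sides (hyperbolicLength_comm I r) hf
      rw [hang hr'.1 h₁ h₂ h₃, hang hr.1 h₁ h₂ h₃]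
      exact hyperbolic_triangle_monotone h₁ h₂ h₃ (by linarith) (by linarith) (by linarith)
        (hr.1 i) (hr.1 j) (hr.1 k) (hr'.1 i) (hr'.1 j) (hr'.1 k) (A := coshHyperbolicAngle)
        (fun _ _ _ => rfl) rfl rfl rfl rfl rfl rfl rfl rfl rfl
        (hyperbolic_gram_pos (hlen hr.1 h₁) (hlen hr.1 h₂) (hlen hr.1 h₃) t₁ t₂ t₃) hd)
  funext i
  -- It is enough that every vertex lies on some face, which holds because its link is a nonempty
  -- cycle.
  obtain ⟨j, hj⟩ := T.exists_adj i
  obtain ⟨k, hk⟩ := T.exists_face_of_adj hj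
  exact hyperbolicConformalFactor_injective (sub_eq_zero.mp (hfaces i j k hk).1)

end ClosedTriangulatedSurface

theorem theorem1p1 {V : Type*} [Fintype V] [DecidableEq V] (T : ClosedTriangulatedSurface V)
    (I : Sym2 V → ℝ)
    (hI : ∀ i j : V, T.graph.Adj i j → -1 < I s(i, j))
    (hγ : ∀ i j k : V, ({i, j, k} : Finset V) ∈ T.faces →
      0 ≤ I s(i, j) + I s(i, k) * I s(j, k) ∧
      0 ≤ I s(i, k) + I s(i, j) * I s(j, k) ∧
      0 ≤ I s(j, k) + I s(i, j) * I s(i, k)) :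
    (∀ r r' : V → ℝ, T.IsEuclideanPacking I r → T.IsEuclideanPacking I r' →
      T.euclideanCurvature I r = T.euclideanCurvature I r' →
      ∃ c : ℝ, 0 < c ∧ ∀ i, r' i = c * r i) ∧
    (∀ r r' : V → ℝ, T.IsHyperbolicPacking I r → T.IsHyperbolicPacking I r' →
      T.hyperbolicCurvature I r = T.hyperbolicCurvature I r' →
      r = r') := by
  exact ⟨fun _ _ hr hr' hK => T.euclidean_rigidity I hI hγ hr hr' hK,
    fun _ _ hr hr' hK => T.hyperbolic_rigidity I hI hγ hr hr' hK⟩
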